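/- **Setting (protocol Q-ID).** Let $\mathcal W$ be a finite set of $m$ passwords, let $\mathfrak c:\mathcal W\to\{0,1\}^n$ be the encoding function of a binary code with minimum distance (at least) $d$, i.e. $\mathfrak c(w)$ and $\mathfrak c(w')$ differ in at least $d$ positions whenever $w\ne w'$, let $\mathcal F=\{0,1\}^{\ell\times n}$ be the set of all linear maps $\{0,1\}^n\to\{0,1\}^\ell$, and let $\mathcal G$ be a finite class of hash functions $\mathcal W\to\{0,1\}^\ell$ (the protocol takes $\ell<n$ and $\mathcal G$ strongly two-universal; neither is needed here). For $x,b\in\{0,1\}^n$ put $|x\rangle_b=H^{b_1}|x_1\rangle\otimes\cdots\otimes H^{b_n}|x_n\rangle$ with $H$ the Hadamard matrix. The honest user, holding the password $w$, picks $x\in\{0,1\}^n$ uniformly at random and sends $|x\rangle_{\mathfrak c(w)}$; he picks $f\in\mathcal F$ uniformly at random and sends it; upon receiving $g\in\mathcal G$ from the server he sends $z=f(x)\oplus g(w)$. **Dishonest server.** A dishonest server $\mathsf S^*$ in the (non-adaptive) single-qubit-operations model has an initial state $r$ (a random variable with finite range, which includes all its random coins), stores all $n$ qubits, chooses $g\in\mathcal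 G$ as an arbitrary function of $r,f$, and at the end chooses, as an arbitrary function of $r,f,g,z$, a sequence $\theta=(\theta_1,\dots,\theta_n)$ of orthonormal bases of $\mathbb C^2$ and measures the $i$-th qubit in basis $\theta_i$ for every $i$, observing $y\in\{0,1\}^n$. Its final system $E$ consists of $r,f,g,z,y$ (which determine $\theta$). **User security.** The protocol is $\varepsilon$-secure for the user against $\mathsf S^*$ if, for every joint distribution of the password $W$ and the initial state of $\mathsf S^*$ under which the two are independent, there exists a random variable $W'$ with values in $\mathcal W$, jointly distributed with $(W,E)$ and independent of $W$, such that $$\tfrac12\bigl\|\rho_{WW'E|W\neq W'}-\rho_{W\leftrightarrow W'\leftrightarrow E|W\neq W'}\bigr\|_1\le\varepsilon ,$$ where $\|A\|_1=\mathrm{tr}\sqrt{AA^*}$ and, for a state $\rho_{WW'E}=\sum_{w,w'}P_{WW'}(w,w')\,|w\rangle\langle w|\otimes|w'\rangle\langle w'|\otimes\rho_E^{w,w'}$, one writes $\rho_{W\leftrightarrow W'\leftrightarrow E}=\sum_{w,w'}P_{WW'}(w,w')\,|w\rangle\langle w|\otimes|w'\rangle\langle w'|\otimes\rho_E^{w'}$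 with $\rho_E^{w'}=\sum_{v}P_{W|W'}(v|w')\rho_E^{v,w'}$; the condition is void if $\Pr[W\ne W']=0$. **Theorem.** For every dishonest server $\mathsf S^*$ in the non-adaptive single-qubit-operations model and every $0<\beta<\tfrac14$, Q-ID is $\varepsilon$-secure for the user against $\mathsf S^*$ with $$\varepsilon=\tfrac12\cdot 2^{\frac{\ell}{2}-\frac14(\frac14-\beta)d}+\binom m2\,2^{2\ell}\exp(-2d\beta^2).$$ -/

import Mathlib

namespace QID

noncomputable section

open scoped ComplexOrder MatrixOrder Matrix.Norms.L2Operator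

/-! ### Classical-quantum states and the trace distance -/

/-- The trace norm `‖A‖₁ = tr √(A A*)`. -/
def traceNorm {ι : Type*} [Fintype ι] [DecidableEq ι] (A : Matrix ι ι ℂ) : ℝ :=
  (CFC.sqrt (A * A.conjTranspose)).trace.re

/-- The trace distance `½ ‖ρ - σ‖₁`. -/
def traceDist {ι : Type*} [Fintype ι] [DecidableEq ι] (ρ σ : Matrix ι ι ℂ) : ℝ :=
  1 / 2 * traceNorm (ρ - σ)

section Hybrid

variable {W E : Type*} [Fintype W] [DecidableEq W] [Fintype E] [DecidableEq E]

/-- A hybrid state `ρ_{WW'E}` with classical `W`, `W'` is given by the family of unnormalised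
states `τ w w' = P_{WW'}(w,w') ρ_E^{w,w'}`, so that `P_{WW'}(w,w') = tr (τ w w')`.  This is its
density matrix `∑_{w,w'} P_{WW'}(w,w') |w⟩⟨w| ⊗ |w'⟩⟨w'| ⊗ ρ_E^{w,w'}`. -/
def density (τ : W → W → Matrix E E ℂ) : Matrix (E × (W × W)) (E × (W × W)) ℂ :=
  Matrix.blockDiagonal fun p : W × W => τ p.1 p.2

/-- `Pr[W ≠ W']`. -/
def probNe (τ : W → W → Matrix E E ℂ) : ℂ :=
  ∑ w, ∑ w', if w ≠ w' then (τ w w').trace else 0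

/-- The conditional state `ρ_{WW'E | W ≠ W'}` (it is `0` if `Pr[W ≠ W'] = 0`). -/
def condNe (τ : W → W → Matrix E E ℂ) : W → W → Matrix E E ℂ :=
  fun w w' => if w ≠ w' then (probNe τ)⁻¹ • τ w w' else 0

/-- The state `ρ_{W ↔ W' ↔ E} = ∑_{w,w'} P_{WW'}(w,w') |w⟩⟨w| ⊗ |w'⟩⟨w'| ⊗ ρ_E^{w'}`, where
`ρ_E^{w'} = P_{W'}(w')⁻¹ ∑_v P_{WW'}(v,w') ρ_E^{v,w'}` is the state of `E` given `W' = w'`. -/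
def markov (τ : W → W → Matrix E E ℂ) : W → W → Matrix E E ℂ :=
  fun w w' => (τ w w').trace • (∑ v, (τ v w').trace)⁻¹ • ∑ v, τ v w'

/-- The requirement on the state `ρ_{WE}` after the execution (given by the unnormalised states
`ρ w = P_W(w) ρ_E^w`): there is a random variable `W'` with values in `W`, i.e. an extension of
`ρ_{WE}` to a state `ρ_{WW'E}` with classical `W'`, that is independent of `W` and such that
`ρ_{WW'E | W ≠ W'}` and `ρ_{W ↔ W' ↔ E | W ≠ W'}` are `ε`-close in trace distance. -/
def HidesPassword (ρ : W → Matrix E E ℂ) (ε : ℝ) : Prop :=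
  ∃ τ : W → W → Matrix E E ℂ,
    (∀ w w', (τ w w').PosSemidef) ∧
    (∀ w, ∑ w', τ w w' = ρ w) ∧
    (∀ w w', (τ w w').trace = (∑ v', (τ w v').trace) * ∑ v, (τ v w').trace) ∧
    traceDist (density (condNe τ)) (density (markov (condNe τ))) ≤ ε

end Hybrid

/-! ### Qubits -/

/-- The state space of a qubit. -/
abbrev Qubit : Type := EuclideanSpace ℂ (ZMod 2)

/-- Bit strings of length `k`. -/
abbrev Bits (k : ℕ) : Type := Fin k → ZMod 2

/-- The Hadamard matrix. -/
def hadamard : Matrix (ZMod 2) (ZMod 2) ℂ :=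
  Matrix.of fun a b => ((Real.sqrt 2)⁻¹ : ℂ) * if a = 1 ∧ b = 1 then -1 else 1

/-- The qubit `H^b |x⟩`. -/
def bb84 (b x : ZMod 2) : Qubit :=
  WithLp.toLp 2 ((hadamard ^ b.val).mulVec (Pi.single x 1))

/-- The product vector `v₁ ⊗ ⋯ ⊗ vₙ` in the state space `(ℂ²)^{⊗n}` of `n` qubits. -/
def tensor {n : ℕ} (v : Fin n → Qubit) : EuclideanSpace ℂ (Bits n) :=
  WithLp.toLp 2 fun y => ∏ i, v i (y i)

/-- The `n`-qubit state `|x⟩_b = H^{b₁}|x₁⟩ ⊗ ⋯ ⊗ H^{bₙ}|xₙ⟩`. -/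
def encode {n : ℕ} (b x : Bits n) : EuclideanSpace ℂ (Bits n) :=
  tensor fun i => bb84 (b i) (x i)

/-- A qubit-wise measurement: an orthonormal basis of `ℂ²`, labelled by outcomes, per qubit. -/
abbrev QubitwiseBasis (n : ℕ) : Type := Fin n → OrthonormalBasis (ZMod 2) ℂ Qubit

/-- The probability of observing `y` when `ψ` is measured qubit-wise in the bases `θ`. -/
def outcomeProb {n : ℕ} (θ : QubitwiseBasis n) (ψ : EuclideanSpace ℂ (Bits n)) (y : Bits n) : ℝ :=
  ‖inner ℂ (tensor fun i => θ i (y i)) ψ‖ ^ 2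

/-! ### The protocol against a server restricted to non-adaptive single-qubit measurements -/

/-- A dishonest server that stores all qubits and measures them qubit-wise and non-adaptively at
the end of the protocol.  `R` holds its initial state (including all its random coins).  It picks
the hash function in `G` after having seen `f`, and the measurement bases from all the classical
information: its initial state, `f`, `g` and `z`. -/
structure Server (R G : Type*) (n ℓ : ℕ) where
  chooseHash : R → Matrix (Fin ℓ) (Fin n) (ZMod 2) → G
  chooseBasis : R → Matrix (Fin ℓ) (Fin n) (ZMod 2) → G → Bits ℓ → QubitwiseBasis n

/-- The (classical) system `E` held by the server at the end: its initial state `r`, the messages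
`f`, `g`, `z`, and the outcome `y` of its measurement.  The bases `θ` are a function of these. -/
abbrev View (R G : Type*) (n ℓ : ℕ) : Type _ :=
  R × Matrix (Fin ℓ) (Fin n) (ZMod 2) × G × Bits ℓ × Bits n

instance instDecidableEqView {R G : Type*} [DecidableEq R] [DecidableEq G] {n ℓ : ℕ} :
    DecidableEq (View R G n ℓ) :=
  @instDecidableEqProd R (Matrix (Fin ℓ) (Fin n) (ZMod 2) × G × Bits ℓ × Bits n) _ inferInstance

variable {W R G : Type*} [Fintype W] [DecidableEq W] [Fintype R] [DecidableEq R]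
  [Fintype G] [DecidableEq G] {n ℓ : ℕ}

/-- The joint probability that the password is `w` and the server ends up with the view
`(r, f, g, z, y)`.  `P` is the joint distribution of the password and the server's initial state;
the honest user picks `x` and the linear map `f` uniformly at random, sends `|x⟩_{c(w)}`, then `f`,
and, upon receiving `g`, replies with `z = f(x) ⊕ g(w)`. -/
def runProb (c : W → Bits n) (hash : G → W → Bits ℓ) (S : Server R G n ℓ) (P : W × R → ℝ)
    (w : W) : View R G n ℓ → ℝ :=
  fun (r, f, g, z, y) =>
    ∑ x : Bits n, P (w, r) * (Fintype.card (Bits n) : ℝ)⁻¹ *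
      (Fintype.card (Matrix (Fin ℓ) (Fin n) (ZMod 2)) : ℝ)⁻¹ *
      if g = S.chooseHash r f ∧ z = f.mulVec x + hash g w then
        outcomeProb (S.chooseBasis r f g z) (encode (c w) x) y
      else 0

/-- The state `ρ_{WE}` after the execution, as the unnormalised states `P_W(w) ρ_E^w`. -/
def finalState (c : W → Bits n) (hash : G → W → Bits ℓ) (S : Server R G n ℓ) (P : W × R → ℝ)
    (w : W) : Matrix (View R G n ℓ) (View R G n ℓ) ℂ :=
  Matrix.diagonal fun e => (runProb c hash S P w e : ℂ)

/-- The protocol with encoding function `c` and hash functions `hash g`, `g ∈ G`, is `ε`-secure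
for the user against the dishonest server `S`: whatever the joint distribution `P` of the password
`W` and the initial state of `S`, if these are independent, then the final state hides `W`. -/
def UserSecure (c : W → Bits n) (hash : G → W → Bits ℓ) (S : Server R G n ℓ) (ε : ℝ) : Prop :=
  ∀ P ∈ stdSimplex ℝ (W × R),
    (∀ w r, P (w, r) = (∑ r', P (w, r')) * ∑ w', P (w', r)) →
    HidesPassword (finalState c hash S P) ε

end

end QID

namespace QID

open scoped ComplexOrder MatrixOrder Matrix.Norms.L2Operator

/-! ### Diagonal states -/

/-! The server's final system is classical, so all states are diagonal and trace distance is an ℓ¹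
distance. Fix `f` and the bases `θ`. Expanding the constraint `f x = u` in characters shows that the
outcome `y` has weight proportional to `1 + δ y`, where `δ` is a sum over `a ≠ 0` of the characters
of `a ᵥ* f`, with coefficients `±parityBias`. Each coefficient is, up to sign, a product of
single-qubit biases over the support of `a ᵥ* f`. If all of them are small for a password `w`,
Parseval makes `y` almost uniform, hence almost uninformative about `w`.

At most one password escapes this. For any qubit basis, the squared biases towards the two BB84
bases sum to at most 1, so their product is at most 1/2 (`abs_bias_mul_bias_le`). Call `f` good if
for all distinct `w`, `w'` and nonzero `a`, `a'` the supports of `a ᵥ* f` and `a' ᵥ* f` meet in at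
least `t = (1/4 - β)d` positions where the code words differ. For good `f`, the parity biases of two
passwords multiply to at most `2^(-t)`, so only one password can have a squared bias above `2^(-t)`
(`exists_forall_ne_parityBias_sq_le`). This password is `W'`. A Chernoff bound and a union bound
make bad `f` unlikely (`card_not_goodMap_le`).

`W'` depends on `z`, but a good `f` is surjective, so `z` is uniform whatever `w` is, and `W'` is
independent of `W`. For bad `f`, `W'` is resampled from its law given good `f`. Good maps contribute
`½ √(2^ℓ 2^(-t))` to the distance, bad ones at most their probability (`hidesPassword_of_good`). -/

theorem traceNorm_diagonal {ι : Type*} [Fintype ι] [DecidableEq ι] (v : ι → ℝ) :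
    traceNorm (Matrix.diagonal fun i => (v i : ℂ)) = ∑ i, |v i| := by
  have h : CFC.sqrt ((Matrix.diagonal fun i => (v i : ℂ)) *
      (Matrix.diagonal fun i => (v i : ℂ)).conjTranspose) =
      Matrix.diagonal fun i => ((|v i| : ℝ) : ℂ) := by
    apply CFC.sqrt_unique
    · rw [Matrix.diagonal_conjTranspose, Matrix.diagonal_mul_diagonal,
        Matrix.diagonal_mul_diagonal]
      congr 1
      funext i
      simp only [Pi.star_apply, RCLike.star_def, Complex.conj_ofReal]
      rw [← Complex.ofReal_mul, ← Complex.ofReal_mul, abs_mul_abs_self]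
    · rw [Matrix.nonneg_iff_posSemidef]
      refine Matrix.PosSemidef.diagonal fun i => ?_
      exact Complex.zero_le_real.2 (abs_nonneg _)
  rw [traceNorm, h, Matrix.trace_diagonal, ← Complex.ofReal_sum, Complex.ofReal_re]

section Classical

variable {W E : Type*} [Fintype E] [DecidableEq E]

/-- The hybrid state with classical `E` given by the joint weights `T w w' e`. -/
noncomputable def classicalState (T : W → W → E → ℝ) : W → W → Matrix E E ℂ :=
  fun w w' => Matrix.diagonal fun e => (T w w' e : ℂ)

theorem trace_classicalState (T : W → W → E → ℝ) (w w' : W) :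
    (classicalState T w w').trace = ((∑ e, T w w' e : ℝ) : ℂ) := by
  simp [classicalState, Matrix.trace_diagonal]

theorem condNe_classicalState [Fintype W] [DecidableEq W] (T : W → W → E → ℝ) :
    condNe (classicalState T) = classicalState fun w w' e =>
      if w ≠ w' then (∑ v, ∑ v', if v ≠ v' then ∑ e, T v v' e else 0)⁻¹ * T w w' e else 0 := by
  have hp : probNe (classicalState T) =
      ((∑ v, ∑ v', if v ≠ v' then ∑ e, T v v' e else 0 : ℝ) : ℂ) := by
    simp only [probNe, trace_classicalState, Complex.ofReal_sum]
    refine Finset.sum_congr rfl fun v _ => Finset.sum_congr rfl fun v' _ => ?_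
    split_ifs <;> simp
  funext w w'
  rw [condNe, hp]
  by_cases h : w ≠ w'
  · simp only [if_pos h, classicalState, ← Matrix.diagonal_smul]
    congr 1
    funext e
    simp
  · simp [if_neg h, classicalState]

theorem markov_classicalState [Fintype W] (T : W → W → E → ℝ) :
    markov (classicalState T) = classicalState fun w w' e =>
      (∑ e, T w w' e) * ((∑ v, ∑ e, T v w' e)⁻¹ * ∑ v, T v w' e) := by
  funext w w'
  have hs : ∑ v, classicalState T v w' =
      Matrix.diagonal fun e => ((∑ v, T v w' e : ℝ) : ℂ) := by
    ext e e'
    by_cases h : e = e'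
    · subst h
      simp [classicalState, Matrix.sum_apply]
    · simp [classicalState, Matrix.sum_apply, h]
  rw [markov, hs]
  simp only [trace_classicalState]
  simp only [classicalState, ← Matrix.diagonal_smul]
  congr 1
  funext e
  simp

theorem traceDist_classicalState [Fintype W] [DecidableEq W] (T U : W → W → E → ℝ) :
    traceDist (density (classicalState T)) (density (classicalState U)) =
      1 / 2 * ∑ w', ∑ w, ∑ e, |T w w' e - U w w' e| := by
  have h : density (classicalState T) - density (classicalState U) =
      Matrix.diagonal fun q : E × (W × W) =>
        ((T q.2.1 q.2.2 q.1 - U q.2.1 q.2.2 q.1 : ℝ) : ℂ) := by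
    simp only [density, classicalState, Matrix.blockDiagonal_diagonal, Matrix.diagonal_sub]
    congr 1
    funext q
    simp
  rw [traceDist, h, traceNorm_diagonal, Fintype.sum_prod_type_right, Fintype.sum_prod_type_right]

/-- If `W'` is sampled from the classical `E` by the kernel `k` and is independent of `W`, then it
suffices to bound, for each value `w'` of `W'`, the deviation of `(W, E)` from independence. -/
theorem hidesPassword_of_kernel [Fintype W] [DecidableEq W] (p : W → E → ℝ) (k : E → W → ℝ)
    (P q : W → ℝ) (ε : ℝ) (hε : 0 ≤ ε) (hp : ∀ w e, 0 ≤ p w e) (hk : ∀ e w, 0 ≤ k e w)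
    (hk1 : ∀ e, ∑ w, k e w = 1) (hP : ∑ w, P w = 1) (hq : ∑ w, q w = 1)
    (hind : ∀ w w', ∑ e, p w e * k e w' = P w * q w')
    (hdist : ∀ w', ∑ w ∈ Finset.univ.erase w', ∑ e, |p w e * k e w' -
        P w / (∑ v ∈ Finset.univ.erase w', P v) * ∑ v ∈ Finset.univ.erase w', p v e * k e w'|
      ≤ 2 * ε * ((∑ v ∈ Finset.univ.erase w', P v) * q w')) :
    HidesPassword (fun w => Matrix.diagonal fun e => (p w e : ℂ)) ε := by
  set T : W → W → E → ℝ := fun w w' e => p w e * k e w' with hT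
  have hTs : ∀ w w', ∑ e, T w w' e = P w * q w' := hind
  refine ⟨classicalState T, ?_, ?_, ?_, ?_⟩
  · intro w w'
    refine Matrix.PosSemidef.diagonal fun e => ?_
    exact Complex.zero_le_real.2 (mul_nonneg (hp _ _) (hk _ _))
  · intro w
    ext e e'
    by_cases h : e = e'
    · subst h
      simp only [classicalState, Matrix.sum_apply, Matrix.diagonal_apply_eq, hT]
      rw [← Complex.ofReal_sum, ← Finset.mul_sum, hk1, mul_one]
    · simp [classicalState, Matrix.sum_apply, h]
  · intro w w'
    simp only [trace_classicalState, hTs, ← Complex.ofReal_sum, ← Complex.ofReal_mul]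
    rw [← Finset.mul_sum, ← Finset.sum_mul, hP, hq, mul_one, one_mul]
  · rw [condNe_classicalState, markov_classicalState, traceDist_classicalState]
    simp only [hTs]
    set N : ℝ := ∑ v, ∑ v', if v ≠ v' then P v * q v' else 0 with hN
    have hPq : ∀ w w', 0 ≤ P w * q w' := fun w w' => by
      rw [← hTs]; exact Finset.sum_nonneg fun e _ => mul_nonneg (hp _ _) (hk _ _)
    have hN' : N = ∑ w', (∑ v ∈ Finset.univ.erase w', P v) * q w' := by
      rw [hN, Finset.sum_comm]
      refine Finset.sum_congr rfl fun w' _ => ?_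
      rw [Finset.sum_mul, ← Finset.sum_filter]
      congr 1
      ext v; simp
    have hN0 : 0 ≤ N := by
      rw [hN]
      refine Finset.sum_nonneg fun v _ => Finset.sum_nonneg fun v' _ => ?_
      split_ifs
      · exact hPq _ _
      · exact le_rfl
    rcases hN0.eq_or_lt with h0 | h0
    -- Here `Pr[W ≠ W'] = 0`; the convention `0⁻¹ = 0` makes both states vanish.
    · simp only [← h0]
      simpa using hε
    have key : ∀ w', ∑ w, ∑ e, |(if w ≠ w' then N⁻¹ * T w w' e else 0) -
        (∑ e, if w ≠ w' then N⁻¹ * T w w' e else 0) *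
          ((∑ v, ∑ e, if v ≠ w' then N⁻¹ * T v w' e else 0)⁻¹ *
            ∑ v, if v ≠ w' then N⁻¹ * T v w' e else 0)| ≤
        N⁻¹ * (2 * ε * ((∑ v ∈ Finset.univ.erase w', P v) * q w')) := by
      intro w'
      refine le_trans (le_of_eq ?_) (mul_le_mul_of_nonneg_left (hdist w') (inv_nonneg.2 hN0))
      have hfil : Finset.univ.filter (fun v => v ≠ w') = Finset.univ.erase w' := by
        ext v; simp
      have hsum : ∀ g : W → ℝ, (∑ v, if v ≠ w' then N⁻¹ * g v else 0) =
          N⁻¹ * ∑ v ∈ Finset.univ.erase w', g v := by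
        intro g
        rw [← Finset.sum_filter, hfil, Finset.mul_sum]
      have hin : ∀ w, (∑ e, if w ≠ w' then N⁻¹ * T w w' e else 0) =
          if w ≠ w' then N⁻¹ * (P w * q w') else 0 := by
        intro w
        split_ifs
        · rw [← Finset.mul_sum, hTs]
        · simp
      simp only [hin, hsum]
      refine (Finset.sum_erase Finset.univ (a := w') ?_).symm.trans ?_
      · simp
      refine Eq.trans ?_ (Finset.mul_sum _ _ _).symm
      refine Finset.sum_congr rfl fun w hw => ?_
      have hw' : w ≠ w' := Finset.ne_of_mem_erase hw
      simp only [if_pos hw']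
      refine Eq.trans ?_ (Finset.mul_sum _ _ _).symm
      refine Finset.sum_congr rfl fun e _ => ?_
      rw [← abs_of_nonneg (inv_nonneg.2 hN0), ← abs_mul, abs_of_nonneg (inv_nonneg.2 hN0)]
      congr 1
      rw [mul_sub]
      congr 1
      rw [← Finset.sum_mul]
      set s := ∑ v ∈ Finset.univ.erase w', P v
      set A := ∑ v ∈ Finset.univ.erase w', T v w' e with hA
      change _ = N⁻¹ * (P w / s * A)
      -- The Markov state is normalised by `N⁻¹ s q(w')`, the hypothesis `hdist` only by `s`. The
      -- extra factors cancel unless `q w' = 0`, in which case nonnegativity kills all weights with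
      -- `W' = w'`.
      by_cases hq0 : q w' = 0
      · have hA0 : A = 0 := by
          refine Finset.sum_eq_zero fun v _ => ?_
          have h1 : ∑ e, T v w' e = 0 := by rw [hTs, hq0, mul_zero]
          exact (Finset.sum_eq_zero_iff_of_nonneg
            (fun e _ => mul_nonneg (hp _ _) (hk _ _))).1 h1 e (Finset.mem_univ _)
        rw [hA0]; simp
      · by_cases hs : s = 0
        · simp [hs]
        · field_simp
    calc _ ≤ 1 / 2 * ∑ w', N⁻¹ * (2 * ε * ((∑ v ∈ Finset.univ.erase w', P v) * q w')) :=
          mul_le_mul_of_nonneg_left (Finset.sum_le_sum fun w' _ => key w') (by norm_num)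
      _ = ε := by
          rw [← Finset.mul_sum, ← Finset.mul_sum, ← hN']
          field_simp

end Classical

/-! ### Deviation from independence -/

/-- Cauchy–Schwarz against the weights `p i * μ e`. The average over `i` turns `δ i` into `δ i - a`
with `a` the `p`-mean of the `δ i`; since a variance is at most the second moment, comparing with
the mixture instead of with `μ` costs no factor 2. -/
theorem sum_abs_mul_sub_average_le {I E : Type*} [Fintype E] (s : Finset I) (p : I → ℝ)
    (μ : E → ℝ) (δ : I → E → ℝ) (B : ℝ) (hB : 0 ≤ B) (hp : ∀ i ∈ s, 0 ≤ p i)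
    (hμ : ∀ e, 0 ≤ μ e) (hδ : ∀ i ∈ s, ∑ e, μ e * δ i e ^ 2 ≤ B ^ 2 * ∑ e, μ e) :
    ∑ i ∈ s, ∑ e, |p i * μ e * (1 + δ i e) -
      p i / (∑ j ∈ s, p j) * ∑ j ∈ s, p j * μ e * (1 + δ j e)| ≤
      B * ((∑ j ∈ s, p j) * ∑ e, μ e) := by
  set σ := ∑ j ∈ s, p j with hσ
  set M := ∑ e, μ e with hM
  have hσ0 : 0 ≤ σ := Finset.sum_nonneg hp
  have hM0 : 0 ≤ M := Finset.sum_nonneg fun e _ => hμ e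
  rcases hσ0.eq_or_lt with h0 | h0
  · have : ∀ i ∈ s, p i = 0 := (Finset.sum_eq_zero_iff_of_nonneg hp).1 h0.symm
    rw [← h0]
    simp only [zero_mul, mul_zero]
    refine le_of_eq (Finset.sum_eq_zero fun i hi => ?_)
    simp [this i hi]
  set a : E → ℝ := fun e => (∑ j ∈ s, p j * δ j e) / σ with ha
  have hterm : ∀ i ∈ s, ∀ e, |p i * μ e * (1 + δ i e) -
      p i / σ * ∑ j ∈ s, p j * μ e * (1 + δ j e)| = p i * μ e * |δ i e - a e| := by
    intro i hi e
    have h1 : ∑ j ∈ s, p j * μ e * (1 + δ j e) = μ e * (σ + σ * a e) := by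
      have : σ * a e = ∑ j ∈ s, p j * δ j e := by rw [ha]; field_simp
      rw [this, hσ, ← Finset.sum_add_distrib, Finset.mul_sum]
      exact Finset.sum_congr rfl fun j _ => by ring
    rw [h1]
    have : p i * μ e * (1 + δ i e) - p i / σ * (μ e * (σ + σ * a e)) =
        p i * μ e * (δ i e - a e) := by field_simp; ring
    rw [this, abs_mul, abs_of_nonneg (mul_nonneg (hp i hi) (hμ e))]
  have hL : ∑ i ∈ s, ∑ e, |p i * μ e * (1 + δ i e) -
      p i / σ * ∑ j ∈ s, p j * μ e * (1 + δ j e)| =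
      ∑ x ∈ s ×ˢ Finset.univ, p x.1 * μ x.2 * |δ x.1 x.2 - a x.2| := by
    rw [Finset.sum_product]
    exact Finset.sum_congr rfl fun i hi => Finset.sum_congr rfl fun e _ => hterm i hi e
  rw [hL]
  have hvar : ∑ x ∈ s ×ˢ (Finset.univ : Finset E), p x.1 * μ x.2 * (δ x.1 x.2 - a x.2) ^ 2 ≤
      σ * (B ^ 2 * M) := by
    have h1 : ∀ e, ∑ i ∈ s, p i * μ e * (δ i e - a e) ^ 2 ≤ ∑ i ∈ s, p i * (μ e * δ i e ^ 2) := by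
      intro e
      have h2 : ∑ i ∈ s, p i * (δ i e - a e) ^ 2 =
          ∑ i ∈ s, p i * δ i e ^ 2 - σ * a e ^ 2 := by
        have h3 : ∑ j ∈ s, p j * δ j e = σ * a e := by rw [ha]; field_simp
        calc _ = ∑ i ∈ s, p i * δ i e ^ 2 - 2 * a e * ∑ i ∈ s, p i * δ i e
              + (∑ i ∈ s, p i) * a e ^ 2 := by
              rw [Finset.mul_sum, Finset.sum_mul, ← Finset.sum_sub_distrib,
                ← Finset.sum_add_distrib]
              exact Finset.sum_congr rfl fun j _ => by ring
          _ = _ := by rw [h3, ← hσ]; ring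
      calc _ = μ e * ∑ i ∈ s, p i * (δ i e - a e) ^ 2 := by
            rw [Finset.mul_sum]; exact Finset.sum_congr rfl fun j _ => by ring
        _ ≤ μ e * ∑ i ∈ s, p i * δ i e ^ 2 := by
            refine mul_le_mul_of_nonneg_left ?_ (hμ e)
            rw [h2]
            nlinarith [mul_nonneg hσ0 (sq_nonneg (a e))]
        _ = _ := by rw [Finset.mul_sum]; exact Finset.sum_congr rfl fun j _ => by ring
    rw [Finset.sum_product_right]
    calc _ ≤ ∑ e, ∑ i ∈ s, p i * (μ e * δ i e ^ 2) := Finset.sum_le_sum fun e _ => h1 e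
      _ = ∑ i ∈ s, p i * ∑ e, μ e * δ i e ^ 2 := by
          rw [Finset.sum_comm]; simp only [Finset.mul_sum]
      _ ≤ ∑ i ∈ s, p i * (B ^ 2 * M) :=
          Finset.sum_le_sum fun i hi => mul_le_mul_of_nonneg_left (hδ i hi) (hp i hi)
      _ = _ := by rw [← Finset.sum_mul]
  have hw : ∑ x ∈ s ×ˢ (Finset.univ : Finset E), p x.1 * μ x.2 = σ * M := by
    rw [Finset.sum_product, hσ, hM, Finset.sum_mul_sum]
  refine abs_le_of_sq_le_sq' (a := _) ?_ (by positivity) |>.2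
  calc _ ≤ (∑ x ∈ s ×ˢ (Finset.univ : Finset E), p x.1 * μ x.2) *
        ∑ x ∈ s ×ˢ (Finset.univ : Finset E), p x.1 * μ x.2 * (δ x.1 x.2 - a x.2) ^ 2 := by
        refine Finset.sum_sq_le_sum_mul_sum_of_sq_le_mul _ ?_ ?_ ?_
        · intro x hx
          exact mul_nonneg (hp _ (Finset.mem_product.1 hx).1) (hμ _)
        · intro x hx
          exact mul_nonneg (mul_nonneg (hp _ (Finset.mem_product.1 hx).1) (hμ _)) (sq_nonneg _)
        · intro x hx
          rw [mul_pow, sq_abs]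
          exact le_of_eq (by ring)
    _ ≤ (σ * M) * (σ * (B ^ 2 * M)) := by
        rw [hw]
        exact mul_le_mul_of_nonneg_left hvar (mul_nonneg hσ0 hM0)
    _ = _ := by ring

/-- Triangle inequality: both terms have the same total mass. This crude bound serves for the bad
`f`. -/
theorem sum_abs_sub_average_le {I E : Type*} [Fintype E] (s : Finset I) (p : I → ℝ)
    (m : ℝ) (T : I → E → ℝ) (hp : ∀ i ∈ s, 0 ≤ p i) (hT : ∀ i ∈ s, ∀ e, 0 ≤ T i e)
    (hs : ∀ i ∈ s, ∑ e, T i e = p i * m) :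
    ∑ i ∈ s, ∑ e, |T i e - p i / (∑ j ∈ s, p j) * ∑ j ∈ s, T j e| ≤
      2 * ((∑ j ∈ s, p j) * m) := by
  set σ := ∑ j ∈ s, p j with hσ
  have hσ0 : 0 ≤ σ := Finset.sum_nonneg hp
  have hsum : ∑ e, ∑ j ∈ s, T j e = σ * m := by
    rw [Finset.sum_comm, hσ, Finset.sum_mul]
    exact Finset.sum_congr rfl hs
  calc _ ≤ ∑ i ∈ s, ∑ e, (T i e + p i / σ * ∑ j ∈ s, T j e) := by
        refine Finset.sum_le_sum fun i hi => Finset.sum_le_sum fun e _ => ?_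
        have h1 := hT i hi e
        have h2 : 0 ≤ p i / σ * ∑ j ∈ s, T j e :=
          mul_nonneg (div_nonneg (hp i hi) hσ0) (Finset.sum_nonneg fun j hj => hT j hj e)
        rw [abs_le]; constructor <;> linarith
    _ = σ * m + σ / σ * (σ * m) := by
        simp only [Finset.sum_add_distrib, ← Finset.mul_sum]
        rw [Finset.sum_comm, hsum, ← Finset.sum_mul, ← Finset.sum_div]
    _ = 2 * (σ * m) := by
        by_cases h : σ = 0
        · simp [h]
        · rw [div_self h]; ring

/-! ### Characters of bit strings -/

/-- The nontrivial character of `ℤ/2`, with real values. -/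
def sgn (a : ZMod 2) : ℝ := if a = 0 then 1 else -1

theorem zmod2_cases (a : ZMod 2) : a = 0 ∨ a = 1 := by
  revert a; decide

@[simp] theorem sgn_zero : sgn 0 = 1 := by simp [sgn]

@[simp] theorem sgn_one : sgn 1 = -1 := by simp [sgn]

theorem sgn_add (a b : ZMod 2) : sgn (a + b) = sgn a * sgn b := by
  rcases zmod2_cases a with rfl | rfl <;> rcases zmod2_cases b with rfl | rfl <;>
    simp [show (1 + 1 : ZMod 2) = 0 from rfl]

theorem sgn_mul_self (a : ZMod 2) : sgn a * sgn a = 1 := by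
  rcases zmod2_cases a with rfl | rfl <;> simp

theorem sgn_sum {ι : Type*} (s : Finset ι) (a : ι → ZMod 2) :
    sgn (∑ i ∈ s, a i) = ∏ i ∈ s, sgn (a i) := by
  classical
  induction s using Finset.induction_on with
  | empty => simp
  | insert i s hi ih => rw [Finset.sum_insert hi, Finset.prod_insert hi, sgn_add, ih]

theorem sum_zmod2 {M : Type*} [AddCommMonoid M] (g : ZMod 2 → M) : ∑ a, g a = g 0 + g 1 :=
  Fin.sum_univ_two g

theorem sum_prod_zmod2 {ι : Type*} [Fintype ι] [DecidableEq ι] {A : Type*} [CommSemiring A]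
    (g : ι → ZMod 2 → A) :
    ∑ x : ι → ZMod 2, ∏ i, g i (x i) = ∏ i, (g i 0 + g i 1) := by
  simp only [← sum_zmod2]
  rw [Finset.prod_univ_sum, Fintype.piFinset_univ]

theorem sum_sgn_dotProduct {ι : Type*} [Fintype ι] [DecidableEq ι] (a : ι → ZMod 2) :
    ∑ v : ι → ZMod 2, sgn (a ⬝ᵥ v) = if a = 0 then 2 ^ Fintype.card ι else 0 := by
  simp only [dotProduct, sgn_sum]
  rw [sum_prod_zmod2 (fun i b => sgn (a i * b))]
  split_ifs with h
  · subst h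
    simp only [Pi.zero_apply, zero_mul, sgn_zero]
    norm_num
  · obtain ⟨i, hi⟩ := Function.ne_iff.1 h
    refine Finset.prod_eq_zero (Finset.mem_univ i) ?_
    rcases zmod2_cases (a i) with h | h
    · exact absurd h hi
    · simp [h]

theorem sum_sgn_dotProduct_left {ι : Type*} [Fintype ι] [DecidableEq ι] (v : ι → ZMod 2) :
    ∑ a : ι → ZMod 2, sgn (a ⬝ᵥ v) = if v = 0 then 2 ^ Fintype.card ι else 0 := by
  simp only [dotProduct_comm _ v]
  exact sum_sgn_dotProduct v

theorem bits_add_eq_zero_iff {ι : Type*} (a b : ι → ZMod 2) : a + b = 0 ↔ a = b := by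
  simp [funext_iff, CharTwo.add_eq_zero]

/-- Parseval's identity. -/
theorem sum_sq_sum_sgn {ι κ : Type*} [Fintype ι] [DecidableEq ι] (S : Finset κ)
    (s : κ → ι → ZMod 2) (hs : ∀ a ∈ S, ∀ b ∈ S, s a = s b → a = b) (B : κ → ℝ) :
    ∑ y : ι → ZMod 2, (∑ a ∈ S, B a * sgn (s a ⬝ᵥ y)) ^ 2 =
      2 ^ Fintype.card ι * ∑ a ∈ S, B a ^ 2 := by
  classical
  have h1 : ∀ y : ι → ZMod 2, (∑ a ∈ S, B a * sgn (s a ⬝ᵥ y)) ^ 2 =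
      ∑ a ∈ S, ∑ b ∈ S, B a * B b * sgn ((s a + s b) ⬝ᵥ y) := by
    intro y
    rw [sq, Finset.sum_mul_sum]
    refine Finset.sum_congr rfl fun a _ => Finset.sum_congr rfl fun b _ => ?_
    rw [add_dotProduct, sgn_add]; ring
  simp only [h1]
  rw [Finset.sum_comm, Finset.mul_sum]
  refine Finset.sum_congr rfl fun a ha => ?_
  rw [Finset.sum_comm, Finset.sum_eq_single_of_mem a ha]
  · rw [← Finset.mul_sum, sum_sgn_dotProduct, if_pos ((bits_add_eq_zero_iff _ _).2 rfl)]; ring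
  · intro b hb hab
    rw [← Finset.mul_sum, sum_sgn_dotProduct, if_neg, mul_zero]
    intro h
    exact hab (hs _ hb _ ha ((bits_add_eq_zero_iff _ _).1 h).symm)

/-- In the character expansion of the indicator, only the constant and the character of `a + a'` can
survive summation. The fraction is thus 1/4 if `a ≠ a'` and 1/2 otherwise. -/
theorem quarter_le_card_filter {ℓ : ℕ} (a a' : Bits ℓ) (ha : a ≠ 0) (ha' : a' ≠ 0) :
    (2 : ℝ) ^ ℓ / 4 ≤ ∑ v : Bits ℓ, if a ⬝ᵥ v = 1 ∧ a' ⬝ᵥ v = 1 then (1 : ℝ) else 0 := by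
  have h1 : ∀ v : Bits ℓ, (if a ⬝ᵥ v = 1 ∧ a' ⬝ᵥ v = 1 then (1 : ℝ) else 0) =
      (1 - sgn (a ⬝ᵥ v) - sgn (a' ⬝ᵥ v) + sgn ((a + a') ⬝ᵥ v)) / 4 := by
    intro v
    rw [add_dotProduct, sgn_add]
    rcases zmod2_cases (a ⬝ᵥ v) with h | h <;> rcases zmod2_cases (a' ⬝ᵥ v) with h' | h' <;>
      (simp [h, h']; try norm_num)
  simp only [h1]
  rw [← Finset.sum_div, Finset.sum_add_distrib, Finset.sum_sub_distrib, Finset.sum_sub_distrib,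
    sum_sgn_dotProduct, sum_sgn_dotProduct, sum_sgn_dotProduct, if_neg ha, if_neg ha']
  have : (∑ _v : Bits ℓ, (1 : ℝ)) = 2 ^ ℓ := by simp
  rw [this]
  have h0 : (0 : ℝ) ≤ if a + a' = 0 then 2 ^ Fintype.card (Fin ℓ) else 0 := by
    split_ifs <;> positivity
  linarith

/-! ### Random linear maps -/

theorem exp_neg_le_quadratic {x : ℝ} (hx : 0 ≤ x) : Real.exp (-x) ≤ 1 - x + x ^ 2 / 2 := by
  have h1 := Real.quadratic_le_exp_of_nonneg hx
  have h2 : 0 < 1 - x + x ^ 2 / 2 := by nlinarith [sq_nonneg (x - 1)]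
  have h3 : Real.exp (-x) * Real.exp x = 1 := by rw [← Real.exp_add]; simp
  have h4 : 1 ≤ (1 - x + x ^ 2 / 2) * Real.exp x := by
    -- The product on the right equals `1 + x ^ 4 / 4`.
    calc (1 : ℝ) ≤ (1 - x + x ^ 2 / 2) * (1 + x + x ^ 2 / 2) := by nlinarith [sq_nonneg (x ^ 2)]
      _ ≤ _ := mul_le_mul_of_nonneg_left h1 h2.le
  have := Real.exp_pos x
  by_contra! h
  nlinarith

/-- The number of positions in `D` at which both parities `a ᵥ* f` and `a' ᵥ* f` are `1`. -/
def jointWeight {n ℓ : ℕ} (D : Finset (Fin n)) (a a' : Bits ℓ)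
    (f : Matrix (Fin ℓ) (Fin n) (ZMod 2)) : ℕ :=
  (D.filter fun i => Matrix.vecMul a f i = 1 ∧ Matrix.vecMul a' f i = 1).card

/-- The columns of a uniform `f` are independent and uniform, so the moment generating function
factors over positions. -/
theorem sum_exp_jointWeight {n ℓ : ℕ} (D : Finset (Fin n)) (a a' : Bits ℓ) (t : ℝ) :
    ∑ f : Matrix (Fin ℓ) (Fin n) (ZMod 2), Real.exp (-(t * jointWeight D a a' f)) =
      ∏ i : Fin n, ∑ v : Bits ℓ,
        if i ∈ D ∧ a ⬝ᵥ v = 1 ∧ a' ⬝ᵥ v = 1 then Real.exp (-t) else 1 := by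
  rw [Finset.prod_univ_sum, Fintype.piFinset_univ]
  rw [← (Equiv.piComm fun (_ : Fin ℓ) (_ : Fin n) => ZMod 2).sum_comp]
  refine Finset.sum_congr rfl fun f _ => ?_
  have h1 : ∀ i (b : Bits ℓ), Matrix.vecMul b f i = b ⬝ᵥ (fun j => f j i) := fun i b => rfl
  have h2 : (jointWeight D a a' f : ℝ) = ∑ i : Fin n,
      if i ∈ D ∧ a ⬝ᵥ (fun j => f j i) = 1 ∧ a' ⬝ᵥ (fun j => f j i) = 1 then (1 : ℝ) else 0 := by
    simp only [jointWeight, h1, Finset.card_filter, ite_and, Nat.cast_sum]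
    rw [← Finset.sum_filter]
    simp
  rw [h2, Finset.mul_sum, ← Finset.sum_neg_distrib, Real.exp_sum]
  refine Finset.prod_congr rfl fun i _ => ?_
  change _ = if i ∈ D ∧ a ⬝ᵥ (fun j => f j i) = 1 ∧ a' ⬝ᵥ (fun j => f j i) = 1
    then Real.exp (-t) else 1
  split_ifs <;> simp

/-- A Hoeffding bound for the joint weight under a uniformly random linear map. -/
theorem card_jointWeight_lt_le {n ℓ : ℕ} (D : Finset (Fin n)) (d : ℕ) (hd : d ≤ D.card)
    (a a' : Bits ℓ) (ha : a ≠ 0) (ha' : a' ≠ 0) (β : ℝ) (hβ₀ : 0 < β) (hβ₁ : β < 1 / 4) :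
    ((Finset.univ.filter fun f : Matrix (Fin ℓ) (Fin n) (ZMod 2) =>
        (jointWeight D a a' f : ℝ) < (1 / 4 - β) * d).card : ℝ) ≤
      Fintype.card (Matrix (Fin ℓ) (Fin n) (ZMod 2)) * Real.exp (-2 * d * β ^ 2) := by
  have hcard : (Fintype.card (Matrix (Fin ℓ) (Fin n) (ZMod 2)) : ℝ) = ((2 : ℝ) ^ ℓ) ^ n := by
    rw [Fintype.card_congr Matrix.of.symm]
    simp [← pow_mul, mul_comm]
  -- The Chernoff parameter `s = 4 * β` minimises the exponent `-s * β + s ^ 2 / 8` per position of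
  -- `D`, giving `-2 * β ^ 2`.
  have hcol : ∀ i : Fin n, (∑ v : Bits ℓ,
      if i ∈ D ∧ a ⬝ᵥ v = 1 ∧ a' ⬝ᵥ v = 1 then Real.exp (-(4 * β)) else 1) ≤
      2 ^ ℓ * if i ∈ D then Real.exp (-β + 2 * β ^ 2) else 1 := by
    intro i
    by_cases hi : i ∈ D
    · simp only [hi, true_and, if_true]
      have h1 : ∀ v : Bits ℓ, (if a ⬝ᵥ v = 1 ∧ a' ⬝ᵥ v = 1 then Real.exp (-(4 * β)) else 1) =
          1 - (1 - Real.exp (-(4 * β))) * if a ⬝ᵥ v = 1 ∧ a' ⬝ᵥ v = 1 then (1 : ℝ) else 0 := by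
        intro v; split_ifs <;> ring
      simp only [h1]
      rw [Finset.sum_sub_distrib, ← Finset.mul_sum]
      have h2 : (∑ _v : Bits ℓ, (1 : ℝ)) = 2 ^ ℓ := by simp
      have h3 := quarter_le_card_filter a a' ha ha'
      have h4 : Real.exp (-(4 * β)) ≤ 1 := Real.exp_le_one_iff.2 (by linarith)
      have h5 := exp_neg_le_quadratic (x := 4 * β) (by linarith)
      have h6 := Real.add_one_le_exp (-β + 2 * β ^ 2)
      rw [h2]
      have h7 := mul_le_mul_of_nonneg_left h3 (sub_nonneg.2 h4)
      have h8 : (0 : ℝ) < 2 ^ ℓ := by positivity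
      calc _ ≤ 2 ^ ℓ - (1 - Real.exp (-(4 * β))) * (2 ^ ℓ / 4) := by linarith
        _ = 2 ^ ℓ * (1 - (1 - Real.exp (-(4 * β))) / 4) := by ring
        _ ≤ _ := by
          refine mul_le_mul_of_nonneg_left ?_ h8.le
          nlinarith
    · simp [hi]
  have hexp : ∀ f : Matrix (Fin ℓ) (Fin n) (ZMod 2),
      (if (jointWeight D a a' f : ℝ) < (1 / 4 - β) * d then (1 : ℝ) else 0) ≤
      Real.exp (4 * β * ((1 / 4 - β) * D.card)) *
        Real.exp (-(4 * β * jointWeight D a a' f)) := by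
    intro f
    split_ifs with h
    · rw [← Real.exp_add]
      refine Real.one_le_exp ?_
      have h1 : (d : ℝ) ≤ D.card := by exact_mod_cast hd
      have h2 : (1 / 4 - β) * (d : ℝ) ≤ (1 / 4 - β) * D.card :=
        mul_le_mul_of_nonneg_left h1 (by linarith)
      nlinarith
    · positivity
  calc _ = ∑ f : Matrix (Fin ℓ) (Fin n) (ZMod 2),
        if (jointWeight D a a' f : ℝ) < (1 / 4 - β) * d then (1 : ℝ) else 0 := by simp
    _ ≤ ∑ f : Matrix (Fin ℓ) (Fin n) (ZMod 2), Real.exp (4 * β * ((1 / 4 - β) * D.card)) *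
        Real.exp (-(4 * β * jointWeight D a a' f)) := Finset.sum_le_sum fun f _ => hexp f
    _ ≤ Real.exp (4 * β * ((1 / 4 - β) * D.card)) *
        ∏ i : Fin n, (2 ^ ℓ * if i ∈ D then Real.exp (-β + 2 * β ^ 2) else 1) := by
        rw [← Finset.mul_sum, sum_exp_jointWeight]
        refine mul_le_mul_of_nonneg_left ?_ (Real.exp_pos _).le
        refine Finset.prod_le_prod (fun i _ => Finset.sum_nonneg fun v _ => ?_) fun i _ => hcol i
        split_ifs <;> positivity
    _ = Fintype.card (Matrix (Fin ℓ) (Fin n) (ZMod 2)) * Real.exp (-2 * D.card * β ^ 2) := by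
        rw [Finset.prod_mul_distrib, Finset.prod_const, Finset.card_univ, Fintype.card_fin, hcard,
          Finset.prod_ite_mem, Finset.univ_inter, Finset.prod_const, ← Real.exp_nat_mul,
          mul_left_comm, ← Real.exp_add]
        congr 2
        ring
    _ ≤ _ := by
        refine mul_le_mul_of_nonneg_left (Real.exp_le_exp.2 ?_) (Nat.cast_nonneg _)
        have h1 : (d : ℝ) ≤ D.card := by exact_mod_cast hd
        nlinarith [mul_le_mul_of_nonneg_right h1 (sq_nonneg β)]

/-- For every two distinct code words and all nonzero `a`, `a'`, the parities `a ᵥ* f` and `a' ᵥ* f`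
overlap in at least `t` of the positions at which the code words differ. -/
def GoodMap {W : Type*} {n ℓ : ℕ} (c : W → Bits n) (t : ℝ)
    (f : Matrix (Fin ℓ) (Fin n) (ZMod 2)) : Prop :=
  ∀ w w', w ≠ w' → ∀ a a' : Bits ℓ, a ≠ 0 → a' ≠ 0 →
    t ≤ jointWeight (Finset.univ.filter fun i => c w i ≠ c w' i) a a' f

-- Union bound over pairs of passwords and over the `2 ^ (2 * ℓ)` pairs `(a, a')`.
open Classical in
theorem card_not_goodMap_le {W : Type*} [Fintype W] {n ℓ : ℕ} (d : ℕ)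
    (c : W → Bits n) (hd : ∀ w w', w ≠ w' → d ≤ hammingDist (c w) (c w'))
    (β : ℝ) (hβ₀ : 0 < β) (hβ₁ : β < 1 / 4) :
    ((Finset.univ.filter fun f : Matrix (Fin ℓ) (Fin n) (ZMod 2) =>
        ¬ GoodMap c ((1 / 4 - β) * d) f).card : ℝ) ≤
      Fintype.card (Matrix (Fin ℓ) (Fin n) (ZMod 2)) *
        (((Fintype.card W).choose 2 : ℝ) * 2 ^ (2 * ℓ) * Real.exp (-2 * d * β ^ 2)) := by
  set bad : W → W → Bits ℓ × Bits ℓ → Finset (Matrix (Fin ℓ) (Fin n) (ZMod 2)) :=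
    fun w w' b => Finset.univ.filter fun f => b.1 ≠ 0 ∧ b.2 ≠ 0 ∧
      (jointWeight (Finset.univ.filter fun i => c w i ≠ c w' i) b.1 b.2 f : ℝ)
        < (1 / 4 - β) * d with hbad
  -- Exchanging the passwords amounts to exchanging `a` and `a'`, so unordered pairs of passwords
  -- suffice; hence the binomial coefficient.
  have hswap : ∀ w w' b, bad w w' b = bad w' w b.swap := by
    intro w w' b
    ext f
    have h1 : (Finset.univ.filter fun i => c w i ≠ c w' i) =
        Finset.univ.filter fun i => c w' i ≠ c w i := by
      ext i; simp [eq_comm]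
    have h2 : ∀ D : Finset (Fin n), jointWeight D b.1 b.2 f = jointWeight D b.2 b.1 f := by
      intro D; simp only [jointWeight, and_comm]
    simp only [hbad, Finset.mem_filter, Finset.mem_univ, true_and, Prod.fst_swap, Prod.snd_swap,
      h1, h2]
    tauto
  have hle : ∀ w w' b, w ≠ w' → ((bad w w' b).card : ℝ) ≤
      Fintype.card (Matrix (Fin ℓ) (Fin n) (ZMod 2)) * Real.exp (-2 * d * β ^ 2) := by
    intro w w' b hw
    by_cases hb : b.1 ≠ 0 ∧ b.2 ≠ 0
    · refine le_trans ?_ (card_jointWeight_lt_le (Finset.univ.filter fun i => c w i ≠ c w' i) d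
        (hd w w' hw) b.1 b.2 hb.1 hb.2 β hβ₀ hβ₁)
      refine Nat.cast_le.2 (Finset.card_le_card fun f hf => ?_)
      simp only [hbad, Finset.mem_filter, Finset.mem_univ, true_and] at hf ⊢
      exact hf.2.2
    · have : bad w w' b = ∅ := by
        ext f
        simp only [hbad, Finset.mem_filter, Finset.mem_univ, true_and, Finset.notMem_empty,
          iff_false]
        tauto
      rw [this]
      simp only [Finset.card_empty, Nat.cast_zero]
      positivity
  set U : Finset W → Finset (Matrix (Fin ℓ) (Fin n) (ZMod 2)) := fun s =>
    (s ×ˢ s).biUnion fun p => if p.1 ≠ p.2 then Finset.univ.biUnion (bad p.1 p.2) else ∅ with hU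
  have hUle : ∀ s ∈ (Finset.univ : Finset W).powersetCard 2, ((U s).card : ℝ) ≤ 2 ^ (2 * ℓ) *
      (Fintype.card (Matrix (Fin ℓ) (Fin n) (ZMod 2)) * Real.exp (-2 * d * β ^ 2)) := by
    intro s hs
    obtain ⟨w, w', hw, rfl⟩ := Finset.card_eq_two.1 (Finset.mem_powersetCard.1 hs).2
    have hsub : U {w, w'} ⊆ Finset.univ.biUnion (bad w w') := by
      intro f hf
      simp only [hU, Finset.mem_biUnion, Finset.mem_product, Finset.mem_insert,
        Finset.mem_singleton] at hf
      obtain ⟨⟨v, v'⟩, ⟨hv, hv'⟩, hf⟩ := hf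
      replace hv : v = w ∨ v = w' := hv
      replace hv' : v' = w ∨ v' = w' := hv'
      by_cases hvv : v ≠ v'
      · rw [if_pos hvv] at hf
        rcases hv with rfl | rfl <;> rcases hv' with rfl | rfl
        · exact absurd rfl hvv
        · exact hf
        · obtain ⟨b, -, hb⟩ := Finset.mem_biUnion.1 hf
          rw [hswap] at hb
          exact Finset.mem_biUnion.2 ⟨b.swap, Finset.mem_univ _, hb⟩
        · exact absurd rfl hvv
      · simp [if_neg hvv] at hf
    calc ((U {w, w'}).card : ℝ) ≤ ((Finset.univ.biUnion (bad w w')).card : ℝ) :=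
          Nat.cast_le.2 (Finset.card_le_card hsub)
      _ ≤ ∑ b, ((bad w w' b).card : ℝ) := by exact_mod_cast Finset.card_biUnion_le
      _ ≤ ∑ _b : Bits ℓ × Bits ℓ,
          Fintype.card (Matrix (Fin ℓ) (Fin n) (ZMod 2)) * Real.exp (-2 * d * β ^ 2) :=
          Finset.sum_le_sum fun b _ => hle w w' b hw
      _ = _ := by
          rw [Finset.sum_const, Finset.card_univ, nsmul_eq_mul]
          congr 1
          simp [two_mul, pow_add]
  have hsub : (Finset.univ.filter fun f : Matrix (Fin ℓ) (Fin n) (ZMod 2) =>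
      ¬ GoodMap c ((1 / 4 - β) * d) f) ⊆ ((Finset.univ : Finset W).powersetCard 2).biUnion U := by
    intro f hf
    simp only [GoodMap, Finset.mem_filter, Finset.mem_univ, true_and, not_forall, not_le] at hf
    obtain ⟨w, w', hw, a, a', ha, ha', h⟩ := hf
    refine Finset.mem_biUnion.2 ⟨{w, w'}, ?_, ?_⟩
    · exact Finset.mem_powersetCard.2 ⟨Finset.subset_univ _, Finset.card_pair hw⟩
    · refine Finset.mem_biUnion.2 ⟨(w, w'), by simp, ?_⟩
      rw [if_pos hw]
      refine Finset.mem_biUnion.2 ⟨(a, a'), Finset.mem_univ _, ?_⟩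
      simp only [hbad, Finset.mem_filter, Finset.mem_univ, true_and]
      exact ⟨ha, ha', h⟩
  calc _ ≤ ((((Finset.univ : Finset W).powersetCard 2).biUnion U).card : ℝ) :=
        Nat.cast_le.2 (Finset.card_le_card hsub)
    _ ≤ ∑ s ∈ (Finset.univ : Finset W).powersetCard 2, ((U s).card : ℝ) := by
        exact_mod_cast Finset.card_biUnion_le
    _ ≤ _ := Finset.sum_le_sum hUle
    _ = _ := by
        rw [Finset.sum_const, Finset.card_powersetCard, Finset.card_univ, nsmul_eq_mul]
        ring

/-! ### Measuring BB84 qubits -/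

/-- The correlation between the outcome of a measurement in the basis `u` and the bit encoded in
the basis `b`. -/
noncomputable def bias (u : OrthonormalBasis (ZMod 2) ℂ Qubit) (b : ZMod 2) : ℝ :=
  2 * ‖inner ℂ (u 0) (bb84 b 0)‖ ^ 2 - 1

theorem bb84_zero_apply (x i : ZMod 2) : bb84 0 x i = if i = x then 1 else 0 := by
  simp [bb84, Matrix.one_apply]

theorem bb84_one_apply (x i : ZMod 2) :
    bb84 1 x i = ((Real.sqrt 2)⁻¹ : ℂ) * if i = 1 ∧ x = 1 then -1 else 1 := by
  have : (1 : ZMod 2).val = 1 := rfl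
  simp [bb84, this, hadamard]

theorem qubit_inner (u v : Qubit) :
    inner ℂ u v = (starRingEnd ℂ) (u 0) * v 0 + (starRingEnd ℂ) (u 1) * v 1 := by
  rw [PiLp.inner_apply, sum_zmod2]
  simp [mul_comm]

theorem qubit_norm_sq (u : Qubit) : ‖u‖ ^ 2 = ‖u 0‖ ^ 2 + ‖u 1‖ ^ 2 := by
  rw [EuclideanSpace.norm_sq_eq, sum_zmod2]

theorem sq_norm_inner_bb84_zero (u : Qubit) (x : ZMod 2) :
    ‖inner ℂ u (bb84 0 x)‖ ^ 2 = ‖u x‖ ^ 2 := by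
  rw [qubit_inner, bb84_zero_apply, bb84_zero_apply]
  rcases zmod2_cases x with rfl | rfl <;> simp

theorem sq_norm_inner_bb84_one (u : Qubit) (x : ZMod 2) :
    ‖inner ℂ u (bb84 1 x)‖ ^ 2 = ‖u 0 + sgn x * u 1‖ ^ 2 / 2 := by
  have h : inner ℂ u (bb84 1 x) =
      ((Real.sqrt 2)⁻¹ : ℂ) * (starRingEnd ℂ) (u 0 + sgn x * u 1) := by
    rw [qubit_inner, bb84_one_apply, bb84_one_apply]
    rcases zmod2_cases x with rfl | rfl <;> simp <;> ring
  rw [h, norm_mul, mul_pow, RCLike.norm_conj]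
  have : ‖((Real.sqrt 2)⁻¹ : ℂ)‖ ^ 2 = 1 / 2 := by
    rw [← Complex.ofReal_inv, Complex.norm_real, Real.norm_eq_abs, sq_abs, inv_pow,
      Real.sq_sqrt (by norm_num)]
    norm_num
  rw [this]; ring

theorem sum_sq_norm_inner_bb84 (u : Qubit) (b : ZMod 2) :
    ‖inner ℂ u (bb84 b 0)‖ ^ 2 + ‖inner ℂ u (bb84 b 1)‖ ^ 2 = ‖u‖ ^ 2 := by
  rw [qubit_norm_sq]
  rcases zmod2_cases b with rfl | rfl
  · rw [sq_norm_inner_bb84_zero, sq_norm_inner_bb84_zero]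
  · rw [sq_norm_inner_bb84_one, sq_norm_inner_bb84_one]
    have := parallelogram_law_with_norm ℂ (u 0) (u 1)
    simp only [sgn_zero, sgn_one, Complex.ofReal_one, Complex.ofReal_neg, one_mul, neg_mul,
      ← sub_eq_add_neg]
    nlinarith

theorem norm_bb84 (b x : ZMod 2) : ‖bb84 b x‖ ^ 2 = 1 := by
  rw [qubit_norm_sq]
  rcases zmod2_cases b with rfl | rfl
  · rw [bb84_zero_apply, bb84_zero_apply]
    rcases zmod2_cases x with rfl | rfl <;> simp
  · rw [bb84_one_apply, bb84_one_apply]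
    have : ‖((Real.sqrt 2)⁻¹ : ℂ)‖ ^ 2 = 1 / 2 := by
      rw [← Complex.ofReal_inv, Complex.norm_real, Real.norm_eq_abs, sq_abs, inv_pow,
        Real.sq_sqrt (by norm_num)]
      norm_num
    simp only [norm_mul, mul_pow, this]
    rcases zmod2_cases x with rfl | rfl <;> norm_num

/-- The 2×2 matrix of transition probabilities is doubly stochastic, hence determined by one entry.
-/
theorem sq_norm_inner_bb84 (u : OrthonormalBasis (ZMod 2) ℂ Qubit) (b x y : ZMod 2) :
    ‖inner ℂ (u y) (bb84 b x)‖ ^ 2 = (1 + sgn (x + y) * bias u b) / 2 := by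
  have hrow : ∀ y, ‖inner ℂ (u y) (bb84 b 0)‖ ^ 2 + ‖inner ℂ (u y) (bb84 b 1)‖ ^ 2 = 1 := by
    intro y
    rw [sum_sq_norm_inner_bb84, u.norm_eq_one, one_pow]
  have hcol : ∀ x, ‖inner ℂ (u 0) (bb84 b x)‖ ^ 2 + ‖inner ℂ (u 1) (bb84 b x)‖ ^ 2 = 1 := by
    intro x
    rw [← sum_zmod2 (fun y => ‖inner ℂ (u y) (bb84 b x)‖ ^ 2), u.sum_sq_norm_inner_right,
      norm_bb84]
  have h0 := hrow 0
  have h1 := hrow 1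
  have h2 := hcol 0
  have h3 : (1 + 1 : ZMod 2) = 0 := rfl
  rcases zmod2_cases x with rfl | rfl <;> rcases zmod2_cases y with rfl | rfl <;>
    simp only [h3, add_zero, zero_add, sgn_zero, sgn_one, bias] <;> linarith

theorem abs_bias_le_one (u : OrthonormalBasis (ZMod 2) ℂ Qubit) (b : ZMod 2) :
    |bias u b| ≤ 1 := by
  have h0 := sq_norm_inner_bb84 u b 0 0
  have h1 := sq_norm_inner_bb84 u b 1 0
  have h2 := sq_nonneg ‖inner ℂ (u 0) (bb84 b 0)‖
  have h3 := sq_nonneg ‖inner ℂ (u 0) (bb84 b 1)‖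
  simp only [add_zero, sgn_zero, sgn_one] at h0 h1
  rw [abs_le]
  constructor <;> linarith

/-- The two biases are the Z and X coordinates of `u 0` on the Bloch sphere. -/
theorem bias_sq_add_bias_sq_le (u : OrthonormalBasis (ZMod 2) ℂ Qubit) :
    bias u 0 ^ 2 + bias u 1 ^ 2 ≤ 1 := by
  have hn : ‖u 0 0‖ ^ 2 + ‖u 0 1‖ ^ 2 = 1 := by
    rw [← qubit_norm_sq, u.norm_eq_one, one_pow]
  have h0 : bias u 0 = ‖u 0 0‖ ^ 2 - ‖u 0 1‖ ^ 2 := by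
    rw [bias, sq_norm_inner_bb84_zero]; linarith
  have h1 : bias u 1 = ‖u 0 0 + u 0 1‖ ^ 2 - 1 := by
    rw [bias, sq_norm_inner_bb84_one]
    simp only [sgn_zero, Complex.ofReal_one, one_mul]; ring
  have h2 : |bias u 1| ≤ 2 * ‖u 0 0‖ * ‖u 0 1‖ := by
    rw [h1, abs_le]
    have hp := norm_add_le (u 0 0) (u 0 1)
    have hm := abs_norm_sub_norm_le (u 0 0) (-(u 0 1))
    rw [norm_neg, sub_neg_eq_add] at hm
    have h3 : (‖u 0 0‖ - ‖u 0 1‖) ^ 2 ≤ ‖u 0 0 + u 0 1‖ ^ 2 := by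
      rw [← sq_abs]
      exact pow_le_pow_left₀ (abs_nonneg _) hm 2
    have h4 := pow_le_pow_left₀ (norm_nonneg _) hp 2
    constructor <;> nlinarith
  have h5 : bias u 1 ^ 2 ≤ (2 * ‖u 0 0‖ * ‖u 0 1‖) ^ 2 := by
    rw [← sq_abs]
    exact pow_le_pow_left₀ (abs_nonneg _) h2 2
  have h6 : bias u 0 ^ 2 + (2 * ‖u 0 0‖ * ‖u 0 1‖) ^ 2 = (‖u 0 0‖ ^ 2 + ‖u 0 1‖ ^ 2) ^ 2 := by
    rw [h0]; ring
  rw [hn] at h6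
  linarith

theorem abs_bias_mul_bias_le (u : OrthonormalBasis (ZMod 2) ℂ Qubit) (b b' : ZMod 2)
    (h : b ≠ b') : |bias u b| * |bias u b'| ≤ 1 / 2 := by
  have key : |bias u 0| * |bias u 1| ≤ 1 / 2 := by
    have := bias_sq_add_bias_sq_le u
    rw [← sq_abs (bias u 0), ← sq_abs (bias u 1)] at this
    nlinarith [sq_nonneg (|bias u 0| - |bias u 1|)]
  rcases zmod2_cases b with rfl | rfl <;> rcases zmod2_cases b' with rfl | rfl
  · exact absurd rfl h
  · exact key
  · rw [mul_comm]; exact key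
  · exact absurd rfl h

theorem inner_tensor {n : ℕ} (u v : Fin n → Qubit) :
    inner ℂ (tensor u) (tensor v) = ∏ i, inner ℂ (u i) (v i) := by
  rw [PiLp.inner_apply]
  simp only [tensor, RCLike.inner_apply, map_prod, ← Finset.prod_mul_distrib]
  rw [sum_prod_zmod2 (fun i b => v i b * (starRingEnd ℂ) (u i b))]
  refine Finset.prod_congr rfl fun i _ => ?_
  rw [qubit_inner]; ring

theorem outcomeProb_encode {n : ℕ} (θ : QubitwiseBasis n) (b x y : Bits n) :
    outcomeProb θ (encode b x) y = ∏ i, (1 + sgn (x i + y i) * bias (θ i) (b i)) / 2 := by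
  rw [outcomeProb, encode, inner_tensor, norm_prod, ← Finset.prod_pow]
  exact Finset.prod_congr rfl fun i _ => sq_norm_inner_bb84 _ _ _ _

theorem sum_outcomeProb_encode {n : ℕ} (θ : QubitwiseBasis n) (b x : Bits n) :
    ∑ y, outcomeProb θ (encode b x) y = 1 := by
  simp only [outcomeProb_encode]
  rw [sum_prod_zmod2 (fun i y => (1 + sgn (x i + y) * bias (θ i) (b i)) / 2)]
  refine Finset.prod_eq_one fun i _ => ?_
  simp only [sgn_add, sgn_zero, sgn_one]
  ring

/-! ### Measuring a code word under a parity constraint -/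

/-- The bias of the parity `s ⬝ᵥ x` given the outcome of the measurement. -/
noncomputable def parityBias {n : ℕ} (θ : QubitwiseBasis n) (b s : Bits n) : ℝ :=
  ∏ i, if s i = 0 then 1 else bias (θ i) (b i)

/-- The map from `x` to `y` is a product of binary symmetric channels, which characters diagonalise
with eigenvalue `parityBias`. -/
theorem sum_sgn_mul_outcomeProb {n : ℕ} (θ : QubitwiseBasis n) (b s y : Bits n) :
    ∑ x, sgn (s ⬝ᵥ x) * outcomeProb θ (encode b x) y = parityBias θ b s * sgn (s ⬝ᵥ y) := by
  simp only [outcomeProb_encode, dotProduct, sgn_sum, parityBias, ← Finset.prod_mul_distrib]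
  rw [sum_prod_zmod2
    (fun i x => sgn (s i * x) * ((1 + sgn (x + y i) * bias (θ i) (b i)) / 2))]
  refine Finset.prod_congr rfl fun i _ => ?_
  rcases zmod2_cases (s i) with h | h <;> simp only [h, zero_mul, one_mul, sgn_add, sgn_zero,
    sgn_one, if_true, one_ne_zero, if_false] <;> ring

/-- The relative deviation from uniform of the outcome, given `f x = u`. -/
noncomputable def deviation {n ℓ : ℕ} (θ : QubitwiseBasis n) (b : Bits n)
    (f : Matrix (Fin ℓ) (Fin n) (ZMod 2)) (u : Bits ℓ) (y : Bits n) : ℝ :=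
  ∑ a ∈ Finset.univ.erase 0,
    sgn (a ⬝ᵥ u) * parityBias θ b (Matrix.vecMul a f) * sgn (Matrix.vecMul a f ⬝ᵥ y)

theorem ite_mulVec_eq {n ℓ : ℕ} (f : Matrix (Fin ℓ) (Fin n) (ZMod 2)) (u : Bits ℓ) (x : Bits n) :
    (if f.mulVec x = u then (1 : ℝ) else 0) =
      (2 ^ ℓ)⁻¹ * ∑ a : Bits ℓ, sgn (a ⬝ᵥ u) * sgn (Matrix.vecMul a f ⬝ᵥ x) := by
  have h1 : ∀ a : Bits ℓ, sgn (a ⬝ᵥ u) * sgn (Matrix.vecMul a f ⬝ᵥ x) =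
      sgn (a ⬝ᵥ (f.mulVec x + u)) := by
    intro a
    rw [dotProduct_add, sgn_add, Matrix.dotProduct_mulVec, mul_comm]
  simp only [h1]
  rw [sum_sgn_dotProduct_left]
  simp only [bits_add_eq_zero_iff, Fintype.card_fin]
  split_ifs <;> simp

/-- Expand the indicator of `f x = u` in characters: `a = 0` gives the uniform part, the other `a`
the deviation. -/
theorem sum_outcomeProb_of_mulVec_eq {n ℓ : ℕ} (θ : QubitwiseBasis n) (b : Bits n)
    (f : Matrix (Fin ℓ) (Fin n) (ZMod 2)) (u : Bits ℓ) (y : Bits n) :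
    (∑ x, if f.mulVec x = u then outcomeProb θ (encode b x) y else 0) =
      (2 ^ ℓ)⁻¹ * (1 + deviation θ b f u y) := by
  have h1 : ∀ x, (if f.mulVec x = u then outcomeProb θ (encode b x) y else 0) =
      (2 ^ ℓ)⁻¹ * ∑ a : Bits ℓ, sgn (a ⬝ᵥ u) *
        (sgn (Matrix.vecMul a f ⬝ᵥ x) * outcomeProb θ (encode b x) y) := by
    intro x
    rw [← one_mul (outcomeProb θ (encode b x) y), ← zero_mul (outcomeProb θ (encode b x) y),
      ← ite_mul, ite_mulVec_eq, mul_assoc, Finset.sum_mul]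
    congr 1
    exact Finset.sum_congr rfl fun a _ => by ring
  simp only [h1]
  rw [← Finset.mul_sum, Finset.sum_comm]
  congr 1
  simp only [← Finset.mul_sum, sum_sgn_mul_outcomeProb]
  rw [← Finset.add_sum_erase _ _ (Finset.mem_univ (0 : Bits ℓ))]
  congr 1
  · simp [parityBias]
  · exact Finset.sum_congr rfl fun a _ => by ring

/-- The hypothesis `hf` is surjectivity of `f` in dual form. Only the trivial character survives in
the count of a fibre, so all fibres have the same size. -/
theorem sum_comp_mulVec_add {n ℓ : ℕ} (f : Matrix (Fin ℓ) (Fin n) (ZMod 2))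
    (hf : ∀ a : Bits ℓ, a ≠ 0 → Matrix.vecMul a f ≠ 0) (h : Bits ℓ) (φ : Bits ℓ → ℝ) :
    ∑ x, φ (f.mulVec x + h) = 2 ^ n * (2 ^ ℓ)⁻¹ * ∑ z, φ z := by
  have hfib : ∀ u : Bits ℓ, (∑ x, if f.mulVec x = u then (1 : ℝ) else 0) = 2 ^ n * (2 ^ ℓ)⁻¹ := by
    intro u
    simp only [ite_mulVec_eq]
    rw [← Finset.mul_sum, Finset.sum_comm, mul_comm]
    congr 1
    simp only [← Finset.mul_sum, sum_sgn_dotProduct]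
    rw [Finset.sum_eq_single_of_mem 0 (Finset.mem_univ _)]
    · simp
    · intro a _ ha
      rw [if_neg (hf a ha), mul_zero]
  rw [← Equiv.sum_comp (Equiv.addRight h) φ, Finset.mul_sum]
  calc _ = ∑ x, ∑ u, (if f.mulVec x = u then (1 : ℝ) else 0) * φ (u + h) := by
        refine Finset.sum_congr rfl fun x _ => ?_
        simp
    _ = _ := by
        rw [Finset.sum_comm]
        refine Finset.sum_congr rfl fun u _ => ?_
        rw [← Finset.sum_mul, hfib]
        rfl

/-- Parseval applies because `hf` makes `a ↦ a ᵥ* f` injective, so the characters are distinct;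
there are fewer than `2 ^ ℓ` terms, each at most `κ`. -/
theorem sum_deviation_sq_le {n ℓ : ℕ} (θ : QubitwiseBasis n) (b : Bits n)
    (f : Matrix (Fin ℓ) (Fin n) (ZMod 2)) (hf : ∀ a : Bits ℓ, a ≠ 0 → Matrix.vecMul a f ≠ 0)
    (u : Bits ℓ) (κ : ℝ) (hκ : 0 ≤ κ)
    (hb : ∀ a : Bits ℓ, a ≠ 0 → parityBias θ b (Matrix.vecMul a f) ^ 2 ≤ κ) :
    ∑ y, deviation θ b f u y ^ 2 ≤ 2 ^ n * (2 ^ ℓ * κ) := by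
  simp only [deviation]
  rw [sum_sq_sum_sgn (Finset.univ.erase (0 : Bits ℓ)) (fun a => Matrix.vecMul a f) ?_
    (fun a => sgn (a ⬝ᵥ u) * parityBias θ b (Matrix.vecMul a f)), Fintype.card_fin]
  · refine mul_le_mul_of_nonneg_left ?_ (by positivity)
    calc _ ≤ ∑ a ∈ Finset.univ.erase (0 : Bits ℓ), κ := by
          refine Finset.sum_le_sum fun a ha => ?_
          rw [mul_pow, sq (sgn _), sgn_mul_self, one_mul]
          exact hb a (Finset.ne_of_mem_erase ha)
      _ ≤ ∑ _a : Bits ℓ, κ :=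
          Finset.sum_le_sum_of_subset_of_nonneg (Finset.erase_subset _ _) fun _ _ _ => hκ
      _ = _ := by simp
  · intro a _ a' _ h
    by_contra hne
    refine hf (a + a') (fun h0 => hne ((bits_add_eq_zero_iff _ _).1 h0)) ?_
    rw [Matrix.add_vecMul, bits_add_eq_zero_iff]
    exact h

/-! ### At most one code word is exposed -/

/-- Each position where the bases differ and both parities are supported contributes at most 1/2 by
the uncertainty relation; every other factor is at most 1. -/
theorem abs_parityBias_mul_le {n : ℕ} (θ : QubitwiseBasis n) (b b' s s' : Bits n) :
    |parityBias θ b s| * |parityBias θ b' s'| ≤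
      (1 / 2) ^ ((Finset.univ.filter fun i => b i ≠ b' i).filter
        fun i => s i = 1 ∧ s' i = 1).card := by
  rw [parityBias, parityBias, Finset.abs_prod, Finset.abs_prod, ← Finset.prod_mul_distrib,
    Finset.filter_filter, ← Finset.prod_const, Finset.prod_filter]
  refine Finset.prod_le_prod (fun i _ => by positivity) fun i _ => ?_
  have hle : ∀ (b s : Bits n), |if s i = 0 then (1 : ℝ) else bias (θ i) (b i)| ≤ 1 := by
    intro b s
    split_ifs
    · simp
    · exact abs_bias_le_one _ _
  by_cases h : b i ≠ b' i ∧ s i = 1 ∧ s' i = 1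
  · rw [if_pos h, h.2.1, h.2.2]
    simp only [one_ne_zero, if_false]
    exact abs_bias_mul_bias_le _ _ _ h.1
  · rw [if_neg h]
    exact mul_le_one₀ (hle b s) (abs_nonneg _) (hle b' s')

/-- If two passwords had squared biases above `2^(-t)`, the product of these squares would exceed
`2^(-2t)`, whereas goodness bounds the product of the absolute biases by `2^(-t)`. -/
theorem exists_forall_ne_parityBias_sq_le {W : Type*} [Nonempty W] {n ℓ : ℕ} (c : W → Bits n)
    (t : ℝ) (f : Matrix (Fin ℓ) (Fin n) (ZMod 2)) (hf : GoodMap c t f) (θ : QubitwiseBasis n) :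
    ∃ w₀, ∀ w, w ≠ w₀ → ∀ a : Bits ℓ, a ≠ 0 →
      parityBias θ (c w) (Matrix.vecMul a f) ^ 2 ≤ (1 / 2 : ℝ) ^ t := by
  by_cases h : ∃ w, ∃ a : Bits ℓ, a ≠ 0 ∧
      (1 / 2 : ℝ) ^ t < parityBias θ (c w) (Matrix.vecMul a f) ^ 2
  · obtain ⟨w₀, a₀, ha₀, h₀⟩ := h
    refine ⟨w₀, fun w hw a ha => ?_⟩
    by_contra! h₁
    have hprod : |parityBias θ (c w) (Matrix.vecMul a f)| *
        |parityBias θ (c w₀) (Matrix.vecMul a₀ f)| ≤ (1 / 2 : ℝ) ^ t := by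
      refine (abs_parityBias_mul_le _ _ _ _ _).trans ?_
      rw [← Real.rpow_natCast]
      exact Real.rpow_le_rpow_of_exponent_ge (by norm_num) (by norm_num) (hf w w₀ hw a a₀ ha ha₀)
    have hpos : (0 : ℝ) < (1 / 2 : ℝ) ^ t := Real.rpow_pos_of_pos (by norm_num) _
    have h2 := mul_lt_mul'' h₁ h₀ hpos.le hpos.le
    rw [← sq_abs (parityBias θ (c w) _), ← sq_abs (parityBias θ (c w₀) _), ← mul_pow, ← sq] at h2
    exact absurd (pow_le_pow_left₀ (by positivity) hprod 2) (not_le.2 h2)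
  · push Not at h
    exact ⟨Classical.arbitrary W, fun w _ a ha => h w a ha⟩

/-- Goodness with `a' = a` forces `a ᵥ* f` to have positive weight. This yields surjectivity of good
maps, hence uniformity of `z`. -/
theorem GoodMap.vecMul_ne_zero {W : Type*} [Nontrivial W] {n ℓ : ℕ} {c : W → Bits n} {t : ℝ}
    (ht : 0 < t) {f : Matrix (Fin ℓ) (Fin n) (ZMod 2)} (hf : GoodMap c t f) (a : Bits ℓ)
    (ha : a ≠ 0) : Matrix.vecMul a f ≠ 0 := by
  intro h
  obtain ⟨w, w', hw⟩ := exists_pair_ne W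
  have := hf w w' hw a a ha ha
  simp [jointWeight, h] at this
  linarith

/-! ### Security of the protocol -/

theorem HidesPassword.mono {W E : Type*} [Fintype W] [DecidableEq W] [Fintype E] [DecidableEq E]
    {ρ : W → Matrix E E ℂ} {ε ε' : ℝ} (h : HidesPassword ρ ε) (hε : ε ≤ ε') : HidesPassword ρ ε' := by
  obtain ⟨τ, h1, h2, h3, h4⟩ := h
  exact ⟨τ, h1, h2, h3, h4.trans hε⟩

section Protocol

variable {W R G : Type*} {n ℓ : ℕ}

theorem runProb_nonneg [DecidableEq G] (c : W → Bits n) (hash : G → W → Bits ℓ) (S : Server R G n ℓ)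
    (P : W × R → ℝ) (hP : ∀ p, 0 ≤ P p) (w : W) (e : View R G n ℓ) :
    0 ≤ runProb c hash S P w e := by
  obtain ⟨r, f, g, z, y⟩ := e
  refine Finset.sum_nonneg fun x _ => mul_nonneg (mul_nonneg (mul_nonneg (hP _) ?_) ?_) ?_
  · positivity
  · positivity
  · split_ifs
    · exact sq_nonneg _
    · exact le_rfl

theorem runProb_eq [DecidableEq G] (c : W → Bits n) (hash : G → W → Bits ℓ) (S : Server R G n ℓ)
    (P : W × R → ℝ) (w : W) (r : R) (f : Matrix (Fin ℓ) (Fin n) (ZMod 2)) (g : G) (z : Bits ℓ)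
    (y : Bits n) :
    runProb c hash S P w (r, f, g, z, y) =
      if g = S.chooseHash r f then
        P (w, r) * (2 ^ n)⁻¹ * (Fintype.card (Matrix (Fin ℓ) (Fin n) (ZMod 2)) : ℝ)⁻¹ *
          ((2 ^ ℓ)⁻¹ * (1 + deviation (S.chooseBasis r f g z) (c w) f (z + hash g w) y))
      else 0 := by
  have hcard : (Fintype.card (Bits n) : ℝ) = 2 ^ n := by simp
  simp only [runProb, hcard]
  rw [← Finset.mul_sum]
  by_cases hg : g = S.chooseHash r f
  · rw [if_pos hg, ← sum_outcomeProb_of_mulVec_eq]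
    congr 1
    refine Finset.sum_congr rfl fun x _ => ?_
    have : (g = S.chooseHash r f ∧ z = f.mulVec x + hash g w) ↔
        f.mulVec x = z + hash g w := by
      rw [← bits_add_eq_zero_iff, ← bits_add_eq_zero_iff (f.mulVec x)]
      simp only [hg, true_and]
      rw [add_left_comm]
    simp only [this]
  · simp [hg]

/-- For a function of `g` and `z` alone the outcome `y` sums out, so the bases chosen are
irrelevant. -/
theorem sum_runProb_mul [Fintype G] [DecidableEq G] (c : W → Bits n) (hash : G → W → Bits ℓ)
    (S : Server R G n ℓ) (P : W × R → ℝ) (w : W) (r : R)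
    (f : Matrix (Fin ℓ) (Fin n) (ZMod 2)) (φ : G → Bits ℓ → ℝ) :
    ∑ g, ∑ z, ∑ y, runProb c hash S P w (r, f, g, z, y) * φ g z =
      P (w, r) * (Fintype.card (Matrix (Fin ℓ) (Fin n) (ZMod 2)) : ℝ)⁻¹ * ((2 ^ n)⁻¹ *
        ∑ x, φ (S.chooseHash r f) (f.mulVec x + hash (S.chooseHash r f) w)) := by
  have hcard : (Fintype.card (Bits n) : ℝ) = 2 ^ n := by simp
  have hin : ∀ g z, ∑ y, runProb c hash S P w (r, f, g, z, y) * φ g z =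
      P (w, r) * (2 ^ n)⁻¹ * (Fintype.card (Matrix (Fin ℓ) (Fin n) (ZMod 2)) : ℝ)⁻¹ *
        ∑ x, if g = S.chooseHash r f then (if z = f.mulVec x + hash g w then φ g z else 0)
          else 0 := by
    intro g z
    simp only [runProb, hcard]
    rw [← Finset.sum_mul, Finset.sum_comm]
    simp only [← Finset.mul_sum]
    rw [mul_assoc, Finset.sum_mul]
    congr 1
    refine Finset.sum_congr rfl fun x _ => ?_
    by_cases hg : g = S.chooseHash r f
    · by_cases hz : z = f.mulVec x + hash g w
      · simp only [if_pos hg, if_pos hz, if_pos (And.intro hg hz), sum_outcomeProb_encode, one_mul]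
      · simp [hz]
    · simp [hg]
  simp only [hin, ← Finset.mul_sum]
  have : ∑ g, ∑ z, ∑ x, (if g = S.chooseHash r f then
      (if z = f.mulVec x + hash g w then φ g z else 0) else 0) =
      ∑ x, φ (S.chooseHash r f) (f.mulVec x + hash (S.chooseHash r f) w) := by
    rw [Finset.sum_eq_single_of_mem (S.chooseHash r f) (Finset.mem_univ _)]
    · simp only [if_true]
      rw [Finset.sum_comm]
      simp
    · intro g _ hg
      simp [hg]
  rw [this]
  ring

theorem sum_view {M : Type*} [AddCommMonoid M] [Fintype R] [Fintype G] (F : View R G n ℓ → M) :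
    ∑ e, F e = ∑ r, ∑ f, ∑ g, ∑ z, ∑ y, F (r, f, g, z, y) := by
  simp only [Fintype.sum_prod_type]

theorem sum_runProb [Fintype R] [Fintype G] [DecidableEq G] (c : W → Bits n) (hash : G → W → Bits ℓ)
    (S : Server R G n ℓ) (P : W × R → ℝ) (w : W) :
    ∑ e, runProb c hash S P w e = ∑ r, P (w, r) := by
  have hrf : ∀ r f, ∑ g, ∑ z, ∑ y, runProb c hash S P w (r, f, g, z, y) =
      P (w, r) * (Fintype.card (Matrix (Fin ℓ) (Fin n) (ZMod 2)) : ℝ)⁻¹ := by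
    intro r f
    have := sum_runProb_mul c hash S P w r f fun _ _ => 1
    simp only [mul_one] at this
    rw [this]
    simp
  rw [sum_view]
  simp only [hrf, Finset.sum_const, Finset.card_univ, nsmul_eq_mul]
  refine Finset.sum_congr rfl fun r _ => ?_
  have : (Fintype.card (Matrix (Fin ℓ) (Fin n) (ZMod 2)) : ℝ) ≠ 0 := by
    exact_mod_cast Fintype.card_ne_zero
  field_simp

variable [Fintype W] [DecidableEq W] [Fintype R] [DecidableEq R] [Fintype G] [DecidableEq G]

/-- If, for every `f` in `Good` and all bases `θ`, at most the password `sel f θ` is exposed, then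
the final state hides the password up to the probability that `f` is not in `Good`. -/
theorem hidesPassword_of_good [Nonempty W] (c : W → Bits n) (hash : G → W → Bits ℓ)
    (S : Server R G n ℓ) (P : W × R → ℝ) (hP : P ∈ stdSimplex ℝ (W × R))
    (hind : ∀ w r, P (w, r) = (∑ r', P (w, r')) * ∑ w', P (w', r))
    (Good : Finset (Matrix (Fin ℓ) (Fin n) (ZMod 2)))
    (hsurj : ∀ f ∈ Good, ∀ a : Bits ℓ, a ≠ 0 → Matrix.vecMul a f ≠ 0)
    (sel : Matrix (Fin ℓ) (Fin n) (ZMod 2) → QubitwiseBasis n → W) (κ : ℝ) (hκ : 0 ≤ κ)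
    (hsel : ∀ f ∈ Good, ∀ θ w, w ≠ sel f θ → ∀ a : Bits ℓ, a ≠ 0 →
      parityBias θ (c w) (Matrix.vecMul a f) ^ 2 ≤ κ) :
    HidesPassword (finalState c hash S P) (1 / 2 * Real.sqrt (2 ^ ℓ * κ) +
      (1 - Good.card / Fintype.card (Matrix (Fin ℓ) (Fin n) (ZMod 2)))) := by
  set N : ℝ := ((Fintype.card (Matrix (Fin ℓ) (Fin n) (ZMod 2)) : ℕ) : ℝ) with hN
  have hN0 : 0 < N := by rw [hN]; exact_mod_cast Fintype.card_pos
  set γ : ℝ := Good.card / N with hγ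
  have hGN : (Good.card : ℝ) ≤ N := by rw [hN]; exact_mod_cast Finset.card_le_univ Good
  have hγ0 : 0 ≤ γ := by positivity
  have hγ1 : γ ≤ 1 := (div_le_one hN0).2 hGN
  set PW : W → ℝ := fun w => ∑ r, P (w, r) with hPW
  set PR : R → ℝ := fun r => ∑ w, P (w, r) with hPR
  have hind' : ∀ w r, P (w, r) = PW w * PR r := hind
  have hPW0 : ∀ w, 0 ≤ PW w := fun w => Finset.sum_nonneg fun r _ => hP.1 _
  have hPR0 : ∀ r, 0 ≤ PR r := fun r => Finset.sum_nonneg fun w _ => hP.1 _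
  have hPW1 : ∑ w, PW w = 1 := by
    rw [← hP.2, Fintype.sum_prod_type]
  have hPR1 : ∑ r, PR r = 1 := by
    rw [← hP.2, Fintype.sum_prod_type_right]
  set guess : R → Matrix (Fin ℓ) (Fin n) (ZMod 2) → G → Bits ℓ → W :=
    fun r f g z => sel f (S.chooseBasis r f g z) with hguess
  -- The probability that the guess is `w'` when `z` is uniform.
  set A : R → Matrix (Fin ℓ) (Fin n) (ZMod 2) → W → ℝ := fun r f w' =>
    (2 ^ ℓ)⁻¹ * ∑ z, if guess r f (S.chooseHash r f) z = w' then (1 : ℝ) else 0 with hA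
  have hA0 : ∀ r f w', 0 ≤ A r f w' := fun r f w' => by
    refine mul_nonneg (by positivity) (Finset.sum_nonneg fun z _ => ?_)
    split_ifs <;> norm_num
  have hA1 : ∀ r f, ∑ w', A r f w' = 1 := fun r f => by
    simp only [hA]
    rw [← Finset.mul_sum, Finset.sum_comm]
    simp
  -- `q` is the law of the guess given that `f` is good. Sampling from it when `f` is bad makes it
  -- the overall law of `W'`. If no `f` is good, any distribution works.
  obtain ⟨q, hq0, hq1, hqG⟩ : ∃ q : W → ℝ, (∀ w', 0 ≤ q w') ∧ ∑ w', q w' = 1 ∧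
      ∀ w', ∑ r, ∑ f ∈ Good, PR r * A r f w' = Good.card * q w' := by
    rcases Good.eq_empty_or_nonempty with h | h
    · refine ⟨Pi.single (Classical.arbitrary W) 1, fun w' => ?_, by simp, by simp [h]⟩
      rw [Pi.single_apply]
      split_ifs <;> norm_num
    · have hc : (0 : ℝ) < Good.card := by exact_mod_cast h.card_pos
      refine ⟨fun w' => (∑ r, ∑ f ∈ Good, PR r * A r f w') / Good.card, fun w' => ?_, ?_,
        fun w' => ?_⟩
      · refine div_nonneg (Finset.sum_nonneg fun r _ => Finset.sum_nonneg fun f _ => ?_) hc.le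
        exact mul_nonneg (hPR0 r) (hA0 r f w')
      · rw [← Finset.sum_div, Finset.sum_comm]
        have : ∀ r, ∑ w', ∑ f ∈ Good, PR r * A r f w' = PR r * Good.card := by
          intro r
          rw [Finset.sum_comm]
          calc _ = ∑ _f ∈ Good, PR r := Finset.sum_congr rfl fun f _ => by
                rw [← Finset.mul_sum, hA1, mul_one]
            _ = _ := by rw [Finset.sum_const, nsmul_eq_mul, mul_comm]
        rw [Finset.sum_congr rfl fun r _ => this r]
        rw [← Finset.sum_mul, hPR1, one_mul, div_self hc.ne']
      · exact (mul_div_cancel₀ _ hc.ne').symm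
  set k : View R G n ℓ → W → ℝ := fun e w' =>
    if e.2.1 ∈ Good then (if guess e.1 e.2.1 e.2.2.1 e.2.2.2.1 = w' then 1 else 0) else q w'
    with hk
  set μ : W → View R G n ℓ → ℝ := fun w' e =>
    if e.2.1 ∈ Good ∧ e.2.2.1 = S.chooseHash e.1 e.2.1 ∧
        guess e.1 e.2.1 e.2.2.1 e.2.2.2.1 = w' then
      PR e.1 * (2 ^ n)⁻¹ * N⁻¹ * (2 ^ ℓ)⁻¹ else 0 with hμ
  set δ : W → View R G n ℓ → ℝ := fun w e =>
    deviation (S.chooseBasis e.1 e.2.1 e.2.2.1 e.2.2.2.1) (c w) e.2.1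
      (e.2.2.2.1 + hash e.2.2.1 w) e.2.2.2.2 with hδ
  set Tb : W → W → View R G n ℓ → ℝ := fun w' w e =>
    if e.2.1 ∈ Good then 0 else runProb c hash S P w e * q w' with hTb
  have hμ0 : ∀ w' e, 0 ≤ μ w' e := fun w' e => by
    simp only [hμ]
    split_ifs
    · have := hPR0 e.1
      positivity
    · exact le_rfl
  have hrun0 : ∀ w e, 0 ≤ runProb c hash S P w e := runProb_nonneg c hash S P hP.1
  have hTb0 : ∀ w' w e, 0 ≤ Tb w' w e := fun w' w e => by
    simp only [hTb]
    split_ifs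
    · exact le_rfl
    · exact mul_nonneg (hrun0 _ _) (hq0 _)
  have hdecomp : ∀ w w' e, runProb c hash S P w e * k e w' =
      PW w * μ w' e * (1 + δ w e) + Tb w' w e := by
    rintro w w' ⟨r, f, g, z, y⟩
    simp only [hk, hμ, hTb, hδ]
    by_cases hf : f ∈ Good
    · simp only [hf, true_and, if_true]
      rw [runProb_eq, hind', ← hN]
      by_cases hg : g = S.chooseHash r f
      · by_cases hs : guess r f g z = w'
        · rw [if_pos hg, if_pos hs, if_pos ⟨hg, hs⟩]
          ring
        · rw [if_neg hs, if_neg (not_and_of_not_right _ hs)]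
          ring
      · rw [if_neg hg, if_neg (not_and_of_not_left _ hg)]
        ring
    · simp only [hf, false_and, if_false]
      ring
  have hsumμ : ∀ w', ∑ e, μ w' e = γ * q w' := by
    intro w'
    have hrf : ∀ r f, ∑ g, ∑ z, ∑ y, μ w' (r, f, g, z, y) =
        if f ∈ Good then N⁻¹ * (PR r * A r f w') else 0 := by
      intro r f
      by_cases hf : f ∈ Good
      · rw [if_pos hf, Finset.sum_eq_single_of_mem (S.chooseHash r f) (Finset.mem_univ _)]
        · simp only [hμ, hf, true_and, hA, Finset.mul_sum]
          refine Finset.sum_congr rfl fun z _ => ?_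
          rw [Finset.sum_const, Finset.card_univ, nsmul_eq_mul]
          have hcard : (Fintype.card (Bits n) : ℝ) = 2 ^ n := by simp
          rw [hcard]
          split_ifs
          · field_simp
          · simp
        · intro g _ hg
          simp [hμ, hg]
      · simp [hμ, hf]
    rw [sum_view]
    simp only [hrf, ← Finset.sum_filter, Finset.filter_mem_eq_inter, Finset.univ_inter,
      ← Finset.mul_sum]
    have := hqG w'
    simp only [← Finset.mul_sum] at this
    rw [this, hγ]
    ring
  have hsumTb : ∀ w' w, ∑ e, Tb w' w e = PW w * ((1 - γ) * q w') := by
    intro w' w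
    have hrf : ∀ r f, ∑ g, ∑ z, ∑ y, Tb w' w (r, f, g, z, y) =
        P (w, r) * (N⁻¹ * q w') * (1 - if f ∈ Good then (1 : ℝ) else 0) := by
      intro r f
      by_cases hf : f ∈ Good
      · simp [hTb, hf]
      · simp only [hTb, if_neg hf]
        rw [sum_runProb_mul c hash S P w r f fun _ _ => q w']
        simp only [Finset.sum_const, Finset.card_univ, nsmul_eq_mul]
        have hcard : (Fintype.card (Bits n) : ℝ) = 2 ^ n := by simp
        rw [hcard, inv_mul_cancel_left₀ (by positivity)]
        ring
    rw [sum_view]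
    simp only [hrf, ← Finset.mul_sum, ← Finset.sum_mul]
    have h1 : ∑ f : Matrix (Fin ℓ) (Fin n) (ZMod 2), (1 - if f ∈ Good then (1 : ℝ) else 0) =
        N - Good.card := by
      rw [Finset.sum_sub_distrib]
      simp [hN]
    rw [h1, hγ]
    change PW w * _ * _ = _
    field_simp
  -- For good `f` the mask `f x` is uniform, so `z`, and with it the guess, does not depend on `w`.
  have hindep : ∀ w w', ∑ e, runProb c hash S P w e * k e w' = PW w * q w' := by
    intro w w'
    have hrf : ∀ r f, ∑ g, ∑ z, ∑ y, runProb c hash S P w (r, f, g, z, y) *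
        (if f ∈ Good then (if guess r f g z = w' then (1 : ℝ) else 0) else 0) =
        if f ∈ Good then PW w * N⁻¹ * (PR r * A r f w') else 0 := by
      intro r f
      by_cases hf : f ∈ Good
      · simp only [if_pos hf]
        rw [sum_runProb_mul c hash S P w r f fun g z => if guess r f g z = w' then (1 : ℝ) else 0,
          sum_comp_mulVec_add f (hsurj f hf) _
            fun z => if guess r f (S.chooseHash r f) z = w' then (1 : ℝ) else 0, hind', ← hN]
        simp only [hA]
        field_simp
      · simp [hf]
    have hsplit : ∀ e, runProb c hash S P w e * k e w' = runProb c hash S P w e *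
        (if e.2.1 ∈ Good then (if guess e.1 e.2.1 e.2.2.1 e.2.2.2.1 = w' then (1 : ℝ) else 0)
          else 0) + Tb w' w e := by
      intro e
      simp only [hk, hTb]
      split_ifs <;> ring
    simp only [hsplit]
    rw [Finset.sum_add_distrib, hsumTb, sum_view]
    simp only [hrf, ← Finset.sum_filter, Finset.filter_mem_eq_inter, Finset.univ_inter,
      ← Finset.mul_sum]
    have := hqG w'
    simp only [← Finset.mul_sum] at this
    rw [this, hγ]
    field_simp
    ring
  have hε : 0 ≤ 1 / 2 * Real.sqrt (2 ^ ℓ * κ) + (1 - γ) := by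
    have := Real.sqrt_nonneg (2 ^ ℓ * κ)
    linarith
  refine hidesPassword_of_kernel (runProb c hash S P) k PW q _ hε hrun0 ?_ ?_ hPW1 hq1 hindep ?_
  · intro e w'
    simp only [hk]
    split_ifs
    · norm_num
    · norm_num
    · exact hq0 w'
  · intro e
    simp only [hk]
    by_cases hf : e.2.1 ∈ Good
    · simp [hf]
    · simp [hf, hq1]
  · intro w'
    set s := ∑ v ∈ Finset.univ.erase w', PW v with hs
    have hs0 : 0 ≤ s := Finset.sum_nonneg fun v _ => hPW0 v
    have hdev : ∀ w ∈ Finset.univ.erase w', ∑ e, μ w' e * δ w e ^ 2 ≤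
        Real.sqrt (2 ^ ℓ * κ) ^ 2 * ∑ e, μ w' e := by
      intro w hw
      have hw' : w ≠ w' := Finset.ne_of_mem_erase hw
      rw [Real.sq_sqrt (by positivity), sum_view, sum_view]
      simp only [Finset.mul_sum]
      refine Finset.sum_le_sum fun r _ => Finset.sum_le_sum fun f _ => Finset.sum_le_sum fun g _ =>
        Finset.sum_le_sum fun z _ => ?_
      simp only [hμ]
      by_cases h : f ∈ Good ∧ g = S.chooseHash r f ∧ guess r f g z = w'
      · simp only [if_pos h]
        rw [← Finset.mul_sum, Finset.sum_const, Finset.card_univ, nsmul_eq_mul]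
        have hcard : (Fintype.card (Bits n) : ℝ) = 2 ^ n := by simp
        have hdd := sum_deviation_sq_le (S.chooseBasis r f g z) (c w) f (hsurj f h.1)
          (z + hash g w) κ hκ (hsel f h.1 _ w fun h' => hw' (h'.trans h.2.2))
        have hm : 0 ≤ PR r * (2 ^ n)⁻¹ * N⁻¹ * (2 ^ ℓ)⁻¹ := by
          have := hPR0 r
          positivity
        calc _ ≤ PR r * (2 ^ n)⁻¹ * N⁻¹ * (2 ^ ℓ)⁻¹ * (2 ^ n * (2 ^ ℓ * κ)) :=
              mul_le_mul_of_nonneg_left hdd hm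
          _ = _ := by rw [hcard]; ring
      · simp [if_neg h]
    have h1 := sum_abs_mul_sub_average_le (Finset.univ.erase w') PW (μ w') δ
      (Real.sqrt (2 ^ ℓ * κ)) (Real.sqrt_nonneg _) (fun w _ => hPW0 w) (hμ0 w') hdev
    have h2 := sum_abs_sub_average_le (Finset.univ.erase w') PW ((1 - γ) * q w') (Tb w')
      (fun w _ => hPW0 w) (fun w _ => hTb0 w' w) (fun w _ => hsumTb w' w)
    rw [hsumμ, ← hs] at h1
    rw [← hs] at h2
    calc _ ≤ ∑ w ∈ Finset.univ.erase w', ∑ e, (|PW w * μ w' e * (1 + δ w e) -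
            PW w / s * ∑ v ∈ Finset.univ.erase w', PW v * μ w' e * (1 + δ v e)| +
          |Tb w' w e - PW w / s * ∑ v ∈ Finset.univ.erase w', Tb w' v e|) := by
          refine Finset.sum_le_sum fun w _ => Finset.sum_le_sum fun e _ => ?_
          simp only [hdecomp, Finset.sum_add_distrib]
          refine le_trans (le_of_eq ?_) (abs_add_le _ _)
          congr 1
          ring
      _ ≤ Real.sqrt (2 ^ ℓ * κ) * (s * (γ * q w')) + 2 * (s * ((1 - γ) * q w')) := by
          simp only [Finset.sum_add_distrib]
          exact add_le_add h1 h2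
      _ ≤ _ := by
          -- The factor `γ ≤ 1` in front of the square root is dropped.
          have h3 : 0 ≤ Real.sqrt (2 ^ ℓ * κ) * (s * q w') * (1 - γ) := by
            have := hq0 w'
            have := sub_nonneg.2 hγ1
            positivity
          nlinarith

theorem hidesPassword_of_subsingleton [Subsingleton W] (c : W → Bits n) (hash : G → W → Bits ℓ)
    (S : Server R G n ℓ) (P : W × R → ℝ) (hP : P ∈ stdSimplex ℝ (W × R)) (ε : ℝ) (hε : 0 ≤ ε) :
    HidesPassword (finalState c hash S P) ε := by
  have hne : (Finset.univ : Finset (W × R)).Nonempty := by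
    by_contra h
    have := hP.2
    rw [Finset.not_nonempty_iff_eq_empty.1 h] at this
    simp at this
  obtain ⟨⟨w₀, -⟩, -⟩ := hne
  have huniv : (Finset.univ : Finset W) = {w₀} := by
    ext v; simp [Subsingleton.elim v w₀]
  have hW : ∀ w, ∑ r, P (w, r) = 1 := by
    intro w
    rw [← hP.2, Fintype.sum_prod_type, huniv, Finset.sum_singleton, Subsingleton.elim w w₀]
  refine hidesPassword_of_kernel (runProb c hash S P) (fun _ _ => 1) (fun _ => 1) (fun _ => 1) ε hε
    (runProb_nonneg c hash S P hP.1) (fun _ _ => zero_le_one) ?_ ?_ ?_ ?_ ?_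
  · intro _
    rw [huniv, Finset.sum_singleton]
  · rw [huniv, Finset.sum_singleton]
  · rw [huniv, Finset.sum_singleton]
  · intro w w'
    simp only [mul_one]
    rw [sum_runProb, hW]
  · intro w'
    have : (Finset.univ : Finset W).erase w' = ∅ := by
      rw [huniv, Subsingleton.elim w' w₀, Finset.erase_singleton]
    simp [this]

end Protocol

end QID

/-! ### The final bound -/

theorem theorem5p3 {W R G : Type*} [Fintype W] [DecidableEq W] [Fintype R] [DecidableEq R]
    [Fintype G] [DecidableEq G] {n ℓ : ℕ} (d : ℕ)
    (c : W → QID.Bits n) (hd : ∀ w w', w ≠ w' → d ≤ hammingDist (c w) (c w'))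
    (hash : G → W → QID.Bits ℓ) (S : QID.Server R G n ℓ)
    (β : ℝ) (hβ₀ : 0 < β) (hβ₁ : β < 1 / 4) :
    QID.UserSecure c hash S
      (1 / 2 * (2 : ℝ) ^ ((ℓ : ℝ) / 2 - 1 / 4 * (1 / 4 - β) * d)
        + ((Fintype.card W).choose 2 : ℝ) * 2 ^ (2 * ℓ) * Real.exp (-2 * d * β ^ 2)) := by
  intro P hP hind
  have hne : (Finset.univ : Finset (W × R)).Nonempty := by
    by_contra h
    have := hP.2
    rw [Finset.not_nonempty_iff_eq_empty.1 h] at this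
    simp at this
  obtain ⟨⟨w₀, -⟩, -⟩ := hne
  have : Nonempty W := ⟨w₀⟩
  have hfirst : (0 : ℝ) ≤ 1 / 2 * (2 : ℝ) ^ ((ℓ : ℝ) / 2 - 1 / 4 * (1 / 4 - β) * d) := by
    positivity
  rcases subsingleton_or_nontrivial W with hW | hW
  · exact QID.hidesPassword_of_subsingleton c hash S P hP _ (by positivity)
  rcases Nat.eq_zero_or_pos d with rfl | hd0
  -- For `d = 0` goodness no longer implies surjectivity, but the claimed bound is at least 1.
  -- Declaring every `f` bad suffices.
  · refine (QID.hidesPassword_of_good c hash S P hP hind ∅ (by simp) (fun _ _ => w₀) 0 le_rfl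
      (by simp)).mono ?_
    have hm : (1 : ℝ) ≤ ((Fintype.card W).choose 2 : ℝ) := by
      exact_mod_cast Nat.choose_pos Fintype.one_lt_card
    have h2 : (1 : ℝ) ≤ 2 ^ (2 * ℓ) := one_le_pow₀ (by norm_num)
    have h3 := one_le_mul_of_one_le_of_one_le hm h2
    simp only [mul_zero, Real.sqrt_zero, Finset.card_empty, Nat.cast_zero, zero_div, sub_zero,
      zero_mul, Real.exp_zero, mul_one] at hfirst ⊢
    linarith
  · classical
    set t : ℝ := (1 / 4 - β) * d with ht
    have ht0 : 0 < t := mul_pos (by linarith) (by exact_mod_cast hd0)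
    set Good : Finset (Matrix (Fin ℓ) (Fin n) (ZMod 2)) :=
      Finset.univ.filter fun f => QID.GoodMap c t f with hGood
    have hmem : ∀ f ∈ Good, QID.GoodMap c t f := fun f hf => (Finset.mem_filter.1 hf).2
    have hex : ∀ f θ, ∃ w₁, f ∈ Good → ∀ w, w ≠ w₁ → ∀ a : QID.Bits ℓ, a ≠ 0 →
        QID.parityBias θ (c w) (Matrix.vecMul a f) ^ 2 ≤ (1 / 2 : ℝ) ^ t := by
      intro f θ
      by_cases hf : f ∈ Good
      · obtain ⟨w₁, h₁⟩ := QID.exists_forall_ne_parityBias_sq_le c t f (hmem f hf) θ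
        exact ⟨w₁, fun _ => h₁⟩
      · exact ⟨w₀, fun h => absurd h hf⟩
    choose sel hsel using hex
    have hκ : (0 : ℝ) ≤ (1 / 2 : ℝ) ^ t := by positivity
    refine (QID.hidesPassword_of_good c hash S P hP hind Good
      (fun f hf => (hmem f hf).vecMul_ne_zero ht0) sel ((1 / 2 : ℝ) ^ t) hκ
      (fun f hf θ => hsel f θ hf)).mono ?_
    refine add_le_add (mul_le_mul_of_nonneg_left ?_ (by norm_num)) ?_
    -- The argument gives the exponent `ℓ/2 - t/2`, which is stronger than the required `ℓ/2 - t/4`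
    -- since `t > 0`.
    · rw [Real.sqrt_eq_rpow, one_div, Real.inv_rpow (by norm_num), ← Real.rpow_neg (by norm_num),
        ← Real.rpow_natCast, ← Real.rpow_add (by norm_num), ← Real.rpow_mul (by norm_num)]
      refine Real.rpow_le_rpow_of_exponent_le (by norm_num) ?_
      have : 1 / 4 * (1 / 4 - β) * (d : ℝ) = t / 4 := by rw [ht]; ring
      rw [this]
      linarith
    · have hN : (0 : ℝ) < Fintype.card (Matrix (Fin ℓ) (Fin n) (ZMod 2)) := by
        exact_mod_cast Fintype.card_pos
      have hbad := QID.card_not_goodMap_le (ℓ := ℓ) d c hd β hβ₀ hβ₁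
      have hsplit := Finset.card_filter_add_card_filter_not (s := Finset.univ)
        fun f : Matrix (Fin ℓ) (Fin n) (ZMod 2) => QID.GoodMap c t f
      rw [Finset.card_univ] at hsplit
      have hsplit' : (Good.card : ℝ) + ((Finset.univ.filter
          fun f : Matrix (Fin ℓ) (Fin n) (ZMod 2) => ¬ QID.GoodMap c t f).card : ℝ) =
          Fintype.card (Matrix (Fin ℓ) (Fin n) (ZMod 2)) := by exact_mod_cast hsplit
      rw [one_sub_div hN.ne', div_le_iff₀ hN, mul_comm]
      linarith
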